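/- Let $V$ be a finite set and, for $\gamma\in V$, let $\mathcal I_\gamma$ be a finite set of levels; let $\mathcal I=\prod_{\gamma\in V}\mathcal I_\gamma$ be the set of cells, assumed to have at least two elements, and fix a baseline cell $i^*\in\mathcal I$. For $E\subseteq V$ let $\mathcal I_E^*=\{i_E\in\prod_{\gamma\in E}\mathcal I_\gamma : i_\gamma\ne i_\gamma^*\ \forall\gamma\in E\}$. Let $G$ be a decomposable graph on $V$: its cliques (maximal complete sets) can be listed without repetition as $C_1,\dots,C_k$ in a perfect order, i.e. each separator $S_l=C_l\cap(C_1\cup\dots\cup C_{l-1})$, $l=2,\dots,k$, is contained in some $C_j$, $j<l$. Fix any such order. Let $\mathcal D$ be the family of nonempty complete subsets of $V$, and for $K\subseteq V$ complete let $\mathcal D^K$ be the family of nonempty subsets of $K$. For $\theta=(\theta(i_D))_{D\in\mathcal D,\,i_D\in\mathcal I_D^*}$ put $$Z(\theta)=1+\sum_{\emptyset\ne E\subseteq V}\ \sum_{i_E\in\mathcal I_E^*}\exp\sum_{F\subseteq E,\,F\in\mathcal D}\theta(i_F),\qquad p_\theta(i_E,i^*_{E^c})=\frac{1}{Z(\theta)}\exp\sum_{F\subseteq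 E,\,F\in\mathcal D}\theta(i_F)\quad(E\subseteq V,\ i_E\in\mathcal I_E^*).$$ Let $s=(s(i_D))_{D\in\mathcal D,\,i_D\in\mathcal I_D^*}$ be real numbers and $\alpha\in\mathbb R$ be such that the conjugate prior with density $$\pi(\theta\mid s,\alpha)=I_{\mathcal D}(s,\alpha)^{-1}\exp\Big\{\sum_{D\in\mathcal D}\sum_{i_D\in\mathcal I_D^*}\theta(i_D)s(i_D)-\alpha\log Z(\theta)\Big\}$$ with respect to Lebesgue measure is proper, i.e. $I_{\mathcal D}(s,\alpha)<\infty$. Let $\mathcal M_G$ be the set of positive probability tables $p$ on $\mathcal I$ with $\sum_{F\subseteq E}(-1)^{|E\setminus F|}\log p(i_F,i^*_{F^c})=0$ for every nonempty $E\notin\mathcal D$ and $i_E\in\mathcal I_E^*$. Write $p^K$ for the $K$-marginal of $p$ and $p^K_\emptyset=p^K(i^*_K)$. Choose for each $D\in\mathcal D$ a separator $A(D)\supseteq D$ if there is one, and otherwise let $A(D)$ be the clique containing $D$; let $p^G=\big(p^{A(D)}(i_D,i^*_{A(D)\setminus D})\big)_{D\in\mathcal D,\,i_D\in\mathcal I_D^*}$.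 For each clique or separator $K$ define $$\alpha^{K}(i_D,i^*_{K\setminus D})=\sum_{D\subseteq F\subseteq K}\ \sum_{j_F\in\mathcal I_F^*,\,(j_F)_D=i_D}(-1)^{|F\setminus D|}s(j_F)\quad(D\in\mathcal D^K,\ i_D\in\mathcal I_D^*),\qquad \alpha^K_\emptyset=\alpha+\sum_{D\in\mathcal D^K}(-1)^{|D|}\sum_{i_D\in\mathcal I_D^*}s(i_D),$$ $$\Gamma_K=\Gamma(\alpha^K_\emptyset)\prod_{D\in\mathcal D^K}\prod_{i_D\in\mathcal I_D^*}\Gamma\big(\alpha^K(i_D,i^*_{K\setminus D})\big),$$ $$\mathrm{Dir}_K(p^K)=\frac{\Gamma\big(\alpha_\emptyset^K+\sum_{D\in\mathcal D^K}\sum_{i_D\in\mathcal I_D^*}\alpha^K(i_D,i^*_{K\setminus D})\big)}{\Gamma_K}\,(p^K_\emptyset)^{\alpha^K_\emptyset-1}\prod_{D\in\mathcal D^K}\prod_{i_D\in\mathcal I_D^*}p^K(i_D,i^*_{K\setminus D})^{\alpha^K(i_D,i^*_{K\setminus D})-1}.$$ Then: 1. On $\mathcal M_G$ the table $p$ is determined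 by $p^G$. 2. The hyperparameters $\alpha^K_\emptyset$ and $\alpha^K(i_D,i^*_{K\setminus D})$ of the cliques and separators are positive, and they are hyperconsistent: for a separator $S$ contained in a clique $K$, the hyperparameter of each cell of the $S$-marginal table is the sum of the hyperparameters of the cells of the $K$-marginal table that project to it. 3. The law of $p^G$ of the table $p_\theta$, when $\theta$ follows the prior $\pi(\cdot\mid s,\alpha)$, is the hyper Dirichlet law with these hyperparameters: it is carried by the set of values of $p^G$ on $\mathcal M_G$, and there it has with respect to Lebesgue measure the density $$\frac{\prod_{l=1}^k\mathrm{Dir}_{C_l}(p^{C_l})}{\prod_{l=2}^k\mathrm{Dir}_{S_l}(p^{S_l})}.$$ 4. The normalizing constant is $$I_{\mathcal D}(s,\alpha)=\frac{\prod_{l=1}^k\Gamma_{C_l}}{\Gamma(\alpha)\prod_{l=2}^k\Gamma_{S_l}}.$$ -/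

import Mathlib

open MeasureTheory

namespace HyperDirichlet

noncomputable section

section Cells

variable {V : Type*} {I : V → Type*}

/-- Marginal cells `i_E` over `E` none of whose components equals the baseline level: `I_E^*`. -/
abbrev StarCell (b : ∀ γ, I γ) (E : Finset V) : Type _ :=
  ∀ γ : E, {x : I γ // x ≠ b γ}

/-- The cell `i(E) = (i_E, i^*_{E^c})`. -/
def extend [DecidableEq V] (b : ∀ γ, I γ) {E : Finset V} (c : StarCell b E) : ∀ γ, I γ :=
  fun γ => if h : γ ∈ E then (c ⟨γ, h⟩ : I γ) else b γ

/-- The family `𝒟` of nonempty complete subsets of the vertex set. -/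
abbrev CompleteSet (G : SimpleGraph V) : Type _ :=
  {D : Finset V // D.Nonempty ∧ G.IsClique (D : Set V)}

/-- The index set of the free log-linear parameters: pairs `(D, i_D)` with `D ∈ 𝒟` and
`i_D ∈ I_D^*`. -/
abbrev Param (G : SimpleGraph V) (b : ∀ γ, I γ) : Type _ :=
  Σ D : CompleteSet G, StarCell b D.1

end Cells

section Model

variable {V : Type*} [Fintype V] [DecidableEq V] {I : V → Type*} [∀ γ, Fintype (I γ)]
  [∀ γ, DecidableEq (I γ)] (G : SimpleGraph V) [DecidableRel G.Adj] (b : ∀ γ, I γ)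

/-- The marginal probability `p^A(c_A)`, the sum of `p i` over the cells `i` with `i_A = c_A`. -/
def marginal (p : (∀ γ, I γ) → ℝ) (A : Finset V) (c : ∀ γ, I γ) : ℝ :=
  ∑ i : (∀ γ, I γ) with ∀ γ ∈ A, i γ = c γ, p i

/-- The log-linear interaction
`θ_E(i_E) = ∑_{F ⊆ E} (-1)^{|E \ F|} log p(i_F, i^*_{F^c})`, for `i_E ∈ I_E^*`. -/
def interaction (p : (∀ γ, I γ) → ℝ) (E : Finset V) (c : StarCell b E) : ℝ :=
  ∑ F ∈ E.powerset, (-1 : ℝ) ^ (E \ F).card * Real.log (p (F.piecewise (extend b c) b))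

/-- The positive probability tables of the graphical log-linear model of `G`: the interactions
indexed by sets which are not complete vanish. -/
def model : Set ((∀ γ, I γ) → ℝ) :=
  {p | (∀ i, 0 < p i) ∧ ∑ i, p i = 1 ∧
    ∀ E : Finset V, E.Nonempty → ¬ G.IsClique (E : Set V) →
      ∀ c : StarCell b E, interaction b p E c = 0}

variable {G b}

/-- `∑ θ(i_F)` over the `F ∈ 𝒟` with `i_F ∈ I_F^*`. For the cell `i = i(E)` with `i_E ∈ I_E^*`,
this is the sum over the `F ∈ 𝒟` with `F ⊆ E`. -/
def logOdds (θ : Param G b → ℝ) (i : ∀ γ, I γ) : ℝ :=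
  ∑ q : Param G b with ∀ γ : q.1.1, (q.2 γ : I γ) = i γ, θ q

/-- `1 + ∑_{E ≠ ∅} ∑_{i_E ∈ I_E^*} exp ∑_{F ⊆ E, F ∈ 𝒟} θ(i_F)`. -/
def partitionFn (θ : Param G b → ℝ) : ℝ :=
  1 + ∑ E : Finset V with E.Nonempty, ∑ c : StarCell b E, Real.exp (logOdds θ (extend b c))

/-- The cell probabilities as functions of the log-linear parameters. -/
def cellProb (θ : Param G b → ℝ) (i : ∀ γ, I γ) : ℝ :=
  Real.exp (logOdds θ i) / partitionFn θ

/-- The unnormalized conjugate prior density with hyperparameters `(s, α)`. -/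
def priorKernel (s : Param G b → ℝ) (α : ℝ) (θ : Param G b → ℝ) : ℝ :=
  Real.exp (∑ q, θ q * s q - α * Real.log (partitionFn θ))

/-- The normalizing constant `I_𝒟(s, α)`. -/
def normConst (s : Param G b → ℝ) (α : ℝ) : ℝ :=
  ∫ θ : Param G b → ℝ, priorKernel s α θ

/-- The conjugate prior law on `θ_𝒟`. -/
def prior (s : Param G b → ℝ) (α : ℝ) : Measure (Param G b → ℝ) :=
  volume.withDensity fun θ => ENNReal.ofReal ((normConst s α)⁻¹ * priorKernel s α θ)

end Model

section Graph

variable {V : Type*} [DecidableEq V]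

/-- With the cliques numbered `C 0, …, C m`, the separator
`C (l+1) ∩ (C 0 ∪ … ∪ C l)`, for `l < m`. -/
def sep {m : ℕ} (C : Fin (m + 1) → Finset V) (l : Fin m) : Finset V :=
  C l.succ ∩ (Finset.univ.filter fun j => j ≤ l.castSucc).biUnion C

/-- `C 0, …, C m` is a perfect ordering of the cliques (maximal complete sets) of `G`: each clique
occurs exactly once, and each separator is contained in an earlier clique (the running intersection
property). A graph is decomposable when such an ordering exists. -/
structure IsPerfectOrdering (G : SimpleGraph V) {m : ℕ} (C : Fin (m + 1) → Finset V) : Prop where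
  injective : Function.Injective C
  mem_range_iff : ∀ K : Finset V,
    K ∈ Set.range C ↔ Maximal (fun K' : Finset V => G.IsClique (K' : Set V)) K
  running_intersection : ∀ l : Fin m, ∃ j, j ≤ l.castSucc ∧ sep C l ⊆ C j

/-- A choice of free marginal probabilities: to each `D ∈ 𝒟` is attached a separator containing
`D` if there is one, and otherwise the clique containing `D`. -/
def IsFreeChoice (G : SimpleGraph V) {m : ℕ} (C : Fin (m + 1) → Finset V)
    (A : CompleteSet G → Finset V) : Prop :=
  ∀ D : CompleteSet G, D.1 ⊆ A D ∧
    ((∃ l, A D = sep C l) ∨ ((∀ l, ¬ D.1 ⊆ sep C l) ∧ ∃ l, A D = C l))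

end Graph

section Law

variable {V : Type*} [Fintype V] [DecidableEq V] {I : V → Type*} [∀ γ, Fintype (I γ)]
  [∀ γ, DecidableEq (I γ)] {G : SimpleGraph V} [DecidableRel G.Adj] {b : ∀ γ, I γ}

/-- The family `p^G` of free clique and separator marginal probabilities of a table `p`: its
`(D, i_D)` entry is `p^{A(D)}(i_D, i^*_{A(D) \ D})`. -/
def freeMarginals (A : CompleteSet G → Finset V) (p : (∀ γ, I γ) → ℝ) : Param G b → ℝ :=
  fun q => marginal p (A q.1) (extend b q.2)

/-- The normalizing product of Gamma functions of a Dirichlet law on the `A`-marginal table, with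
parameter `a0` for the baseline cell and `a (D, i_D)` for the cell `(i_D, i^*_{A \ D})`. -/
def gammaProd (A : Finset V) (a0 : ℝ) (a : Param G b → ℝ) : ℝ :=
  Real.Gamma a0 * ∏ q : Param G b with q.1.1 ⊆ A, Real.Gamma (a q)

/-- The Dirichlet density on the `A`-marginal table, at the `A`-marginal of `p`. -/
def dirichletDensity (A : Finset V) (a0 : ℝ) (a : Param G b → ℝ) (p : (∀ γ, I γ) → ℝ) : ℝ :=
  Real.Gamma (a0 + ∑ q : Param G b with q.1.1 ⊆ A, a q) / gammaProd A a0 a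
    * (marginal p A b ^ (a0 - 1)
      * ∏ q : Param G b with q.1.1 ⊆ A, marginal p A (extend b q.2) ^ (a q - 1))

/-- The product of the Dirichlet densities of the cliques over that of the separators. The
hyperparameters of the marginal table on a clique or separator `K` are `a0 K`, `a K`. -/
def hyperDirichletDensity {m : ℕ} (C : Fin (m + 1) → Finset V)
    (a0 : Finset V → ℝ) (a : Finset V → Param G b → ℝ) (p : (∀ γ, I γ) → ℝ) : ℝ :=
  (∏ l, dirichletDensity (C l) (a0 (C l)) (a (C l)) p) /
    ∏ l, dirichletDensity (sep C l) (a0 (sep C l)) (a (sep C l)) p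

/-- The hyper Dirichlet law in the coordinates `p^G`: it is carried by the set of values of `p^G` on
the model, where its density with respect to Lebesgue measure at `x` is the hyper Dirichlet density
of the table `p` of the model whose `p^G` is `x`. -/
def hyperDirichletLaw {m : ℕ} (C : Fin (m + 1) → Finset V) (A : CompleteSet G → Finset V)
    (a0 : Finset V → ℝ) (a : Finset V → Param G b → ℝ) : Measure (Param G b → ℝ) :=
  volume.withDensity
    ((freeMarginals (b := b) A '' model G b).indicator fun x =>
      ENNReal.ofReal (hyperDirichletDensity C a0 a
        (Function.invFunOn (freeMarginals (b := b) A) (model G b) x)))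

/-- Hyperconsistency: for a separator `S` contained in a clique `K`, the Dirichlet law on `K`
has on `S` the Dirichlet marginal law given by the parameters of `S`, that is, the parameter of each
cell of `S` is the sum of the parameters of the cells of `K` that lie over it. -/
def HyperConsistent {m : ℕ} (C : Fin (m + 1) → Finset V)
    (a0 : Finset V → ℝ) (a : Finset V → Param G b → ℝ) : Prop :=
  ∀ (l : Fin m) (j : Fin (m + 1)), sep C l ⊆ C j →
    (a0 (sep C l) = a0 (C j) +
      ∑ q : Param G b with q.1.1 ⊆ C j ∧ ∀ γ ∈ sep C l, extend b q.2 γ = b γ, a (C j) q) ∧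
    ∀ d : Param G b, d.1.1 ⊆ sep C l →
      a (sep C l) d =
        ∑ q : Param G b with q.1.1 ⊆ C j ∧ ∀ γ ∈ sep C l, extend b q.2 γ = extend b d.2 γ,
          a (C j) q

/-- `α_∅^K = α + ∑_{∅ ≠ D ⊆ K} (-1)^{|D|} ∑_{i_D ∈ I_D^*} s(i_D)`. -/
def alphaEmpty (s : Param G b → ℝ) (α : ℝ) (K : Finset V) : ℝ :=
  α + ∑ q : Param G b with q.1.1 ⊆ K, (-1 : ℝ) ^ q.1.1.card * s q

/-- `α^K(i_D, i^*_{K \ D})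
  = ∑_{D ⊆ F ⊆ K} ∑_{j_F ∈ I_F^*, (j_F)_D = i_D} (-1)^{|F \ D|} s(j_F)`. -/
def alphaCell (s : Param G b → ℝ) (K : Finset V) (d : Param G b) : ℝ :=
  ∑ q : Param G b with d.1.1 ⊆ q.1.1 ∧ q.1.1 ⊆ K ∧ ∀ γ ∈ d.1.1, extend b q.2 γ = extend b d.2 γ,
    (-1 : ℝ) ^ (q.1.1 \ d.1.1).card * s q

end Law

end

end HyperDirichlet

set_option linter.unusedSectionVars false

/-! Order the cells by letting `y` lie below `x` when `y` agrees with `x` wherever `y` differs from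
the baseline. The log-linear parameters of a table are the Möbius transform of `log p` for this
order, and membership in the model says that the transform vanishes off the cells with complete
support. Giving the baseline cell the parameter `-log Z` and the hyperparameter `α` removes the
special role of normalization: the exponent of the prior kernel becomes the pairing of this
transform with `(s, α)`, and the hyperparameters `α^K` are the adjoint Möbius transform of `(s, α)`
over the cells on `K`. Hyperconsistency is then Möbius inversion.

Let a clique `C` be joined to its history `H`, with separator `S = C ∩ H`. Summing out `C \ H`
multiplies the remaining table by a function of the `S`-cell, and since all cells on `S` carry
parameters, this factor is absorbed by a shift of them. Three facts follow, each of the form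
"(joined) times (separator) = (history) times (clique)", and each telescopes along the perfect
ordering: (a) conditional independence of the marginals, hence `p ∏ p^S = ∏ p^C`; (b) for the
normalizing constants of independent Poisson counts (a free baseline parameter instead of `-log Z`),
because Lebesgue measure is invariant under the shift; (c) for the determinants of second moments of
the indicators "above `y`", because the regression on the history uses only the cells on `S`. On a
complete set (b) is a product of Gamma functions and (c) a product of marginal probabilities, by
unimodular triangular substitutions.

Integrating the baseline parameter out of (b) yields `Γ(α)` times the normalizing constant of the
prior. The Jacobian of `θ ↦ p^G` is the determinant in (c): `p^G` is a unimodular linear image of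
the mean parameters, whose derivative is the covariance matrix of the indicators. By (a) the prior
kernel is a quotient of products of powers `p^K(z) ^ α^K(z)`; dividing by the Jacobian lowers each
exponent by one and gives the Dirichlet densities.

Positivity follows from properness: along the direction dual to a cell `z` of the `K`-marginal table
the kernel behaves like `exp(-n α^K(z))` up to bounded factors. Injectivity of `p^G` follows from
the symmetrized Kullback-Leibler divergence. -/

namespace HyperDirichlet

/-! ### Möbius inversion on the order of cells, and the hyperparameters as its adjoint. -/

section CellOrder

variable {V : Type*} [Fintype V] [DecidableEq V] {I : V → Type*} [∀ γ, Fintype (I γ)]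
  [∀ γ, DecidableEq (I γ)] (b : ∀ γ, I γ)

/-- The cell `y` agrees with `x` wherever it differs from the baseline. -/
abbrev Below (y x : ∀ γ, I γ) : Prop := ∀ γ, y γ = b γ ∨ y γ = x γ

/-- The vertices at which a cell differs from the baseline. -/
def support (x : ∀ γ, I γ) : Finset V := Finset.univ.filter fun γ => x γ ≠ b γ

/-- The cells which agree with the baseline off `K`; they stand for the cells of the `K`-marginal
table. -/
def cellsOn (K : Finset V) : Finset (∀ γ, I γ) :=
  Finset.univ.filter fun x => ∀ γ, γ ∉ K → x γ = b γ

/-- The cell `(x_K, i^*_{K^c})`. -/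
def restr (K : Finset V) (x : ∀ γ, I γ) : ∀ γ, I γ := K.piecewise x b

/-- The Möbius function of the order `Below` on cells. -/
noncomputable def mobius (y x : ∀ γ, I γ) : ℝ :=
  if Below b y x then (-1) ^ (support b x \ support b y).card else 0

variable {b}

@[simp] theorem mem_support {x : ∀ γ, I γ} {γ : V} : γ ∈ support b x ↔ x γ ≠ b γ := by
  simp [support]

@[simp] theorem mem_cellsOn {x : ∀ γ, I γ} {K : Finset V} :
    x ∈ cellsOn b K ↔ ∀ γ, γ ∉ K → x γ = b γ := by
  simp [cellsOn]

theorem mem_cellsOn_iff_support {x : ∀ γ, I γ} {K : Finset V} :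
    x ∈ cellsOn b K ↔ support b x ⊆ K := by
  simp only [mem_cellsOn, Finset.subset_iff, mem_support]
  exact forall_congr' fun γ => not_imp_comm

theorem restr_apply_mem {K : Finset V} {γ : V} (h : γ ∈ K) (x : ∀ γ, I γ) :
    restr b K x γ = x γ := by
  simp [restr, h]

theorem restr_apply_notMem {K : Finset V} {γ : V} (h : γ ∉ K) (x : ∀ γ, I γ) :
    restr b K x γ = b γ := by
  simp [restr, h]

theorem restr_mem (K : Finset V) (x : ∀ γ, I γ) : restr b K x ∈ cellsOn b K := by
  simp +contextual [restr]

theorem baseline_mem (K : Finset V) : b ∈ cellsOn b K := by simp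

theorem cellsOn_univ : cellsOn b Finset.univ = Finset.univ := by
  ext; simp

theorem cellsOn_mono {S K : Finset V} (h : S ⊆ K) : cellsOn b S ⊆ cellsOn b K := by
  intro x
  simp only [mem_cellsOn]
  exact fun hx γ hγ => hx γ fun h' => hγ (h h')

theorem restr_eq_self {K : Finset V} {x : ∀ γ, I γ} (hx : x ∈ cellsOn b K) : restr b K x = x := by
  funext γ
  by_cases h : γ ∈ K
  · simp [restr, h]
  · simp [restr, h, mem_cellsOn.1 hx γ h]

theorem restr_restr_of_subset {S K : Finset V} (h : S ⊆ K) (x : ∀ γ, I γ) :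
    restr b S (restr b K x) = restr b S x := by
  funext γ
  by_cases hS : γ ∈ S
  · simp [restr, hS, h hS]
  · simp [restr, hS]

theorem restr_eq_iff {K : Finset V} {x z : ∀ γ, I γ} (hz : z ∈ cellsOn b K) :
    restr b K x = z ↔ ∀ γ ∈ K, x γ = z γ := by
  constructor
  · rintro rfl γ hγ
    simp [restr, hγ]
  · intro h
    funext γ
    by_cases hγ : γ ∈ K
    · simp [restr, hγ, h γ hγ]
    · simp [restr, hγ, mem_cellsOn.1 hz γ hγ]

theorem restr_eq_restr_iff {K : Finset V} {x z : ∀ γ, I γ} :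
    restr b K x = restr b K z ↔ ∀ γ ∈ K, x γ = z γ := by
  rw [restr_eq_iff (restr_mem K z)]
  exact forall₂_congr fun γ hγ => by rw [restr_apply_mem hγ]

theorem baseline_below (x : ∀ γ, I γ) : Below b b x := fun _ => Or.inl rfl

theorem below_baseline_iff {x : ∀ γ, I γ} : Below b x b ↔ x = b := by
  simp [Below, funext_iff]

theorem Below.mem_cellsOn {K : Finset V} {x y : ∀ γ, I γ} (h : Below b y x)
    (hx : x ∈ cellsOn b K) : y ∈ cellsOn b K := by
  rw [HyperDirichlet.mem_cellsOn] at *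
  intro γ hγ
  rcases h γ with h | h
  · exact h
  · rw [h, hx γ hγ]

theorem Below.support_subset {x y : ∀ γ, I γ} (h : Below b y x) : support b y ⊆ support b x :=
  mem_cellsOn_iff_support.1 (h.mem_cellsOn (mem_cellsOn_iff_support.2 subset_rfl))

/-- The size of the support strictly increases along the order; this is the grading that makes the
matrices of the order unitriangular. -/
theorem Below.eq_of_card_le {x y : ∀ γ, I γ} (h : Below b y x)
    (hc : (support b x).card ≤ (support b y).card) : y = x := by
  have hs := Finset.eq_of_subset_of_card_le h.support_subset hc
  funext γ
  rcases h γ with h' | h'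
  · have : γ ∉ support b x := by rw [← hs]; simpa using h'
    simp only [mem_support, not_not] at this
    rw [h', this]
  · exact h'

theorem below_restr_iff {K : Finset V} {x y : ∀ γ, I γ} :
    Below b y (restr b K x) ↔ y ∈ cellsOn b K ∧ Below b y x := by
  constructor
  · intro h
    refine ⟨h.mem_cellsOn (restr_mem K x), fun γ => ?_⟩
    by_cases hγ : γ ∈ K
    · simpa [restr, hγ] using h γ
    · left; simpa [restr, hγ] using h γ
  · rintro ⟨hy, h⟩ γ
    by_cases hγ : γ ∈ K
    · simpa [restr, hγ] using h γ
    · left; exact mem_cellsOn.1 hy γ hγ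

theorem mobius_of_not_below {y x : ∀ γ, I γ} (h : ¬ Below b y x) : mobius b y x = 0 := if_neg h

theorem mobius_self (x : ∀ γ, I γ) : mobius b x x = 1 := by
  simp [mobius]

/-- The order is a product over the vertices of flat orders with the baseline level at the bottom,
so its Möbius function is a product too. This reduces the inversion formula to a single vertex. -/
theorem mobius_eq_prod (y x : ∀ γ, I γ) :
    mobius b y x = ∏ γ, if y γ = x γ then (1 : ℝ) else if y γ = b γ then -1 else 0 := by
  by_cases h : Below b y x
  · have : ∀ γ, (if y γ = x γ then (1 : ℝ) else if y γ = b γ then -1 else 0) =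
        if γ ∈ support b x \ support b y then -1 else 1 := by
      intro γ
      by_cases h' : y γ = x γ
      · have : γ ∉ support b x \ support b y := by simp [h']
        rw [if_pos h', if_neg this]
      · have hy := (h γ).resolve_right h'
        have : γ ∈ support b x \ support b y := by simp [hy, hy ▸ Ne.symm h']
        rw [if_neg h', if_pos hy, if_pos this]
    rw [mobius, if_pos h, Finset.prod_congr rfl fun γ _ => this γ, Finset.prod_ite_mem]
    simp
  · rw [mobius, if_neg h]
    simp only [Below, not_forall, not_or] at h
    obtain ⟨γ, h1, h2⟩ := h
    exact (Finset.prod_eq_zero (Finset.mem_univ γ) (by simp [h1, h2])).symm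

theorem ite_below_eq_prod (y x : ∀ γ, I γ) :
    (if Below b y x then (1 : ℝ) else 0) =
      ∏ γ, if y γ = b γ ∨ y γ = x γ then (1 : ℝ) else 0 := by
  rw [Fintype.prod_boole]

theorem sum_mobius_mul_below (y x : ∀ γ, I γ) :
    ∑ w, mobius b y w * (if Below b w x then (1 : ℝ) else 0) = if y = x then 1 else 0 := by
  simp_rw [mobius_eq_prod, ite_below_eq_prod, ← Finset.prod_mul_distrib]
  rw [← Fintype.prod_sum fun γ (u : I γ) =>
    (if y γ = u then (1 : ℝ) else if y γ = b γ then -1 else 0) *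
      (if u = b γ ∨ u = x γ then 1 else 0)]
  have key : ∀ γ, ∑ u : I γ, (if y γ = u then (1 : ℝ) else if y γ = b γ then -1 else 0) *
      (if u = b γ ∨ u = x γ then 1 else 0) = if y γ = x γ then 1 else 0 := by
    intro γ
    by_cases hy : y γ = b γ
    -- From the bottom level, only `u = b γ` (with sign `+`) and `u = x γ` (with sign `-`, if it is
    -- a different level) contribute.
    · have : ∀ u : I γ, (if y γ = u then (1 : ℝ) else if y γ = b γ then -1 else 0) *
          (if u = b γ ∨ u = x γ then 1 else 0) =
          (if u = b γ then 1 else 0) - (if u = x γ then if x γ = b γ then 0 else 1 else 0) := by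
        intro u
        by_cases h1 : u = b γ
        · subst h1; by_cases h2 : b γ = x γ <;> simp_all
        · by_cases h2 : u = x γ
          · subst h2; simp [hy, h1, Ne.symm h1]
          · simp [h1, h2]
      rw [Finset.sum_congr rfl fun u _ => this u, Finset.sum_sub_distrib]
      simp only [Finset.sum_ite_eq', Finset.mem_univ, if_true, hy]
      by_cases h : x γ = b γ
      · simp [h]
      · simp [h, Ne.symm h]
    · rw [Finset.sum_eq_single (y γ) (fun u _ hu => by simp [hy, Ne.symm hu]) (by simp)]
      simp [hy]
  rw [Finset.prod_congr rfl fun γ _ => key γ, Fintype.prod_boole]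
  simp [funext_iff]

/-- A one-sided inverse of a square matrix is two-sided. -/
theorem sum_below_mul_mobius (y x : ∀ γ, I γ) :
    ∑ w, (if Below b y w then (1 : ℝ) else 0) * mobius b w x = if y = x then 1 else 0 := by
  have h : (Matrix.of (mobius b) : Matrix (∀ γ, I γ) (∀ γ, I γ) ℝ) *
      (Matrix.of fun y x => if Below b y x then (1 : ℝ) else 0) = 1 := by
    ext y x
    rw [Matrix.mul_apply, Matrix.one_apply]
    exact sum_mobius_mul_below y x
  replace h := mul_eq_one_comm.1 h
  have h' := congrFun (congrFun h y) x
  rw [Matrix.mul_apply, Matrix.one_apply] at h'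
  exact h'

/-- The Möbius transform of a function of cells. -/
noncomputable def mobiusTransform (b : ∀ γ, I γ) (f : (∀ γ, I γ) → ℝ) (x : ∀ γ, I γ) : ℝ :=
  ∑ w, mobius b w x * f w

theorem sum_below_mobiusTransform (f : (∀ γ, I γ) → ℝ) (x : ∀ γ, I γ) :
    ∑ y with Below b y x, mobiusTransform b f y = f x := by
  simp only [mobiusTransform]
  rw [Finset.sum_filter]
  have : ∀ y, (if Below b y x then ∑ w, mobius b w y * f w else 0) =
      ∑ w, f w * (mobius b w y * if Below b y x then (1 : ℝ) else 0) := by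
    intro y
    split_ifs
    · exact Finset.sum_congr rfl fun _ _ => by ring
    · simp
  rw [Finset.sum_congr rfl fun y _ => this y, Finset.sum_comm]
  simp_rw [← Finset.mul_sum, sum_mobius_mul_below]
  simp

theorem mobiusTransform_sum_below (f : (∀ γ, I γ) → ℝ) (x : ∀ γ, I γ) :
    mobiusTransform b (fun y => ∑ w with Below b w y, f w) x = f x := by
  simp only [mobiusTransform]
  have : ∀ y, mobius b y x * ∑ w with Below b w y, f w =
      ∑ w, f w * ((if Below b w y then (1 : ℝ) else 0) * mobius b y x) := by
    intro y
    rw [Finset.sum_filter, Finset.mul_sum]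
    refine Finset.sum_congr rfl fun w _ => ?_
    split_ifs <;> ring
  rw [Finset.sum_congr rfl fun y _ => this y, Finset.sum_comm]
  simp_rw [← Finset.mul_sum, sum_below_mul_mobius]
  simp

theorem filter_cellsOn_below (K : Finset V) (x : ∀ γ, I γ) :
    (cellsOn b K).filter (fun y => Below b y x) =
      Finset.univ.filter fun y => Below b y (restr b K x) := by
  ext y
  rw [Finset.mem_filter, Finset.mem_filter, below_restr_iff]
  simp

theorem sum_cellsOn_mobiusTransform (K : Finset V) (f : (∀ γ, I γ) → ℝ) (x : ∀ γ, I γ) :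
    ∑ y ∈ cellsOn b K with Below b y x, mobiusTransform b f y = f (restr b K x) := by
  rw [filter_cellsOn_below, sum_below_mobiusTransform]

/-- A function of `x_K` is recovered from its transform on the cells on `K` alone, so uniqueness of
Möbius inversion kills the other coefficients. -/
theorem mobiusTransform_eq_zero {K : Finset V} {f : (∀ γ, I γ) → ℝ}
    (hf : ∀ x, f (restr b K x) = f x) {y : ∀ γ, I γ} (hy : y ∉ cellsOn b K) :
    mobiusTransform b f y = 0 := by
  have h : f = fun x => ∑ w with Below b w x,
      if w ∈ cellsOn b K then mobiusTransform b f w else 0 := by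
    funext x
    rw [← hf x, ← sum_cellsOn_mobiusTransform K f x, Finset.sum_ite, Finset.sum_const_zero,
      add_zero, Finset.filter_filter]
    refine Finset.sum_congr ?_ fun _ _ => rfl
    ext y
    simp [and_comm]
  rw [h, mobiusTransform_sum_below, if_neg hy]

theorem mobiusTransform_eq_sum_powerset (f : (∀ γ, I γ) → ℝ) (x : ∀ γ, I γ) :
    mobiusTransform b f x =
      ∑ F ∈ (support b x).powerset, (-1 : ℝ) ^ (support b x \ F).card * f (F.piecewise x b) := by
  have hsupp : ∀ F ⊆ support b x, support b (F.piecewise x b) = F := by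
    intro F hF
    ext γ
    by_cases h : γ ∈ F
    · simpa [h] using hF h
    · simp [h]
  have hbelow : ∀ F : Finset V, Below b (F.piecewise x b) x := by
    intro F γ
    by_cases h : γ ∈ F <;> simp [h]
  rw [mobiusTransform, ← Finset.sum_filter_of_ne (p := fun w => Below b w x)
    fun w _ h => by
      by_contra h'
      exact h (by rw [mobius_of_not_below h', zero_mul])]
  symm
  refine Finset.sum_nbij' (fun F => F.piecewise x b) (support b) ?_ ?_ ?_ ?_ ?_
  · intro F _
    simpa using hbelow F
  · intro y hy
    simp only [Finset.mem_filter, Finset.mem_univ, true_and] at hy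
    exact Finset.mem_powerset.2 (Below.support_subset hy)
  · intro F hF
    exact hsupp F (Finset.mem_powerset.1 hF)
  · intro y hy
    simp only [Finset.mem_filter, Finset.mem_univ, true_and] at hy
    funext γ
    by_cases h : γ ∈ support b y
    · have h' : y γ ≠ b γ := by simpa using h
      rw [Finset.piecewise_eq_of_mem _ _ _ h, (hy γ).resolve_left h']
    · have h' : y γ = b γ := by simpa using h
      rw [Finset.piecewise_eq_of_notMem _ _ _ h, h']
  · intro F hF
    rw [mobius, if_pos (hbelow F), hsupp F (Finset.mem_powerset.1 hF)]

/-- The hyperparameters `α^K` of the cells of the `K`-marginal table. -/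
noncomputable def cellHyper (b : ∀ γ, I γ) (s : (∀ γ, I γ) → ℝ) (K : Finset V) (z : ∀ γ, I γ) : ℝ :=
  ∑ q ∈ cellsOn b K, mobius b z q * s q

theorem cellHyper_eq_zero (s : (∀ γ, I γ) → ℝ) {K : Finset V} {z : ∀ γ, I γ}
    (hz : z ∉ cellsOn b K) : cellHyper b s K z = 0 := by
  refine Finset.sum_eq_zero fun q hq => ?_
  rw [mobius_of_not_below fun h => hz (h.mem_cellsOn hq), zero_mul]

theorem sum_mobiusTransform_mul (s f : (∀ γ, I γ) → ℝ) (K : Finset V) :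
    ∑ y ∈ cellsOn b K, mobiusTransform b f y * s y =
      ∑ z ∈ cellsOn b K, cellHyper b s K z * f z := by
  have h : ∑ z ∈ cellsOn b K, cellHyper b s K z * f z = ∑ z, cellHyper b s K z * f z :=
    Finset.sum_subset (Finset.subset_univ _) fun z _ hz => by
      rw [cellHyper_eq_zero s hz, zero_mul]
  rw [h]
  simp only [mobiusTransform, cellHyper, Finset.sum_mul]
  rw [Finset.sum_comm]
  exact Finset.sum_congr rfl fun _ _ => Finset.sum_congr rfl fun _ _ => by ring

/-- This inverts the definition of `cellHyper`: apply the adjunction `sum_mobiusTransform_mul` to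
the indicator of the cells above `y`, whose transform is the point mass at `y`. -/
theorem sum_cellHyper_above (s : (∀ γ, I γ) → ℝ) {K : Finset V} {y : ∀ γ, I γ}
    (hy : y ∈ cellsOn b K) : ∑ w ∈ cellsOn b K with Below b y w, cellHyper b s K w = s y := by
  have h := sum_mobiusTransform_mul (b := b) s (fun w => if Below b y w then (1 : ℝ) else 0) K
  have h' : ∀ x, mobiusTransform b (fun w => if Below b y w then (1 : ℝ) else 0) x =
      if y = x then 1 else 0 := by
    intro x
    rw [← sum_below_mul_mobius, mobiusTransform]
    exact Finset.sum_congr rfl fun _ _ => mul_comm _ _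
  simp_rw [h'] at h
  simp only [mul_ite, mul_one, mul_zero, ite_mul, one_mul, zero_mul, Finset.sum_ite_eq, hy,
    if_true] at h
  rw [Finset.sum_filter, h]

/-- The source of hyperconsistency. For `q` on `S`, `s q` is the sum of the `α^K(w)` over the `w`
above `q`, a condition on `w_S` only; Möbius inversion over the cells on `S` isolates the `w` with
`w_S = z`. -/
theorem cellHyper_restr (s : (∀ γ, I γ) → ℝ) {S K : Finset V} (hSK : S ⊆ K) (z : ∀ γ, I γ) :
    cellHyper b s S z = ∑ w ∈ cellsOn b K with restr b S w = z, cellHyper b s K w := by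
  have key : ∀ q ∈ cellsOn b S, s q = ∑ w ∈ cellsOn b K,
      cellHyper b s K w * (if Below b q (restr b S w) then 1 else 0) := by
    intro q hq
    rw [← sum_cellHyper_above s (cellsOn_mono hSK hq), Finset.sum_filter]
    refine Finset.sum_congr rfl fun w _ => ?_
    simp only [below_restr_iff, hq, true_and]
    split_ifs <;> simp
  rw [cellHyper, Finset.sum_congr rfl fun q hq => by rw [key q hq, Finset.mul_sum],
    Finset.sum_comm, Finset.sum_filter]
  refine Finset.sum_congr rfl fun w _ => ?_
  have h1 : ∑ q ∈ cellsOn b S, mobius b z q * (cellHyper b s K w *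
      (if Below b q (restr b S w) then 1 else 0)) =
      ∑ q, cellHyper b s K w * (mobius b z q * (if Below b q (restr b S w) then 1 else 0)) := by
    rw [Finset.sum_congr rfl fun q _ => mul_left_comm _ _ _]
    refine Finset.sum_subset (Finset.subset_univ _) fun q _ hq => ?_
    rw [if_neg fun h => hq (h.mem_cellsOn (restr_mem S w))]
    simp
  rw [h1, ← Finset.mul_sum, sum_mobius_mul_below]
  simp [eq_comm]

theorem sum_cellHyper (s : (∀ γ, I γ) → ℝ) (K : Finset V) :
    ∑ w ∈ cellsOn b K, cellHyper b s K w = s b := by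
  rw [← sum_cellHyper_above s (baseline_mem K)]
  rw [Finset.filter_true_of_mem fun w _ => baseline_below w]

/-- A square matrix with unit diagonal whose other nonzero entries increase a grading has
determinant one. -/
theorem det_eq_one_of_graded {ι : Type*} [Fintype ι] [DecidableEq ι] (M : Matrix ι ι ℝ)
    (r : ι → ℕ) (hd : ∀ i, M i i = 1) (ht : ∀ i j, M i j ≠ 0 → i ≠ j → r i < r j) :
    M.det = 1 := by
  have hM : M.BlockTriangular r := by
    intro i j hij
    by_contra h
    by_cases hij' : i = j
    · subst hij'; exact lt_irrefl _ hij
    · exact lt_asymm hij (ht i j h hij')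
  rw [hM.det]
  refine Finset.prod_eq_one fun k _ => ?_
  have : M.toSquareBlock r k = 1 := by
    ext ⟨i, hi⟩ ⟨j, hj⟩
    rw [Matrix.toSquareBlock_def, Matrix.one_apply]
    by_cases hij : i = j
    · subst hij; simp [hd]
    · simp only [Subtype.mk.injEq, hij, if_false, Matrix.of_apply]
      by_contra h
      have := ht i j h hij
      omega
  rw [this, Matrix.det_one]

end CellOrder

/-! ### Marginal tables, gluing along a separator, and closure of log-linear tables under
marginalization. -/

section Marginals

variable {V : Type*} [Fintype V] [DecidableEq V] {I : V → Type*} [∀ γ, Fintype (I γ)]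
  [∀ γ, DecidableEq (I γ)] {b : ∀ γ, I γ}

theorem marginal_eq (b : ∀ γ, I γ) (p : (∀ γ, I γ) → ℝ) (K : Finset V) (c : ∀ γ, I γ) :
    marginal p K c = ∑ i with restr b K i = restr b K c, p i := by
  simp only [marginal, restr_eq_restr_iff]

theorem marginal_congr (p : (∀ γ, I γ) → ℝ) {K : Finset V} {c d : ∀ γ, I γ}
    (h : restr b K c = restr b K d) : marginal p K c = marginal p K d := by
  rw [marginal_eq b, marginal_eq b, h]

theorem marginal_restr (p : (∀ γ, I γ) → ℝ) {S K : Finset V} (h : S ⊆ K) (c : ∀ γ, I γ) :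
    marginal p S (restr b K c) = marginal p S c :=
  marginal_congr (b := b) p (restr_restr_of_subset h c)

theorem marginal_univ (p : (∀ γ, I γ) → ℝ) (c : ∀ γ, I γ) : marginal p Finset.univ c = p c := by
  have : (Finset.univ.filter fun i : ∀ γ, I γ => ∀ γ ∈ Finset.univ, i γ = c γ) = {c} := by
    ext i
    simp [funext_iff]
  rw [marginal, this, Finset.sum_singleton]

theorem marginal_pos {p : (∀ γ, I γ) → ℝ} (hp : ∀ i, 0 < p i) (K : Finset V) (c : ∀ γ, I γ) :
    0 < marginal p K c :=
  Finset.sum_pos (fun i _ => hp i) ⟨c, by simp⟩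

theorem sum_mul_restr (p F : (∀ γ, I γ) → ℝ) (K : Finset V) :
    ∑ x, p x * F (restr b K x) = ∑ u ∈ cellsOn b K, marginal p K u * F u := by
  rw [← Finset.sum_fiberwise_of_maps_to (g := restr b K) (t := cellsOn b K)
    fun x _ => restr_mem K x]
  refine Finset.sum_congr rfl fun u hu => ?_
  rw [marginal_eq b, Finset.sum_mul, restr_eq_self hu]
  refine Finset.sum_congr rfl fun x hx => ?_
  rw [(Finset.mem_filter.1 hx).2]

theorem marginal_eq_sum_marginal (p : (∀ γ, I γ) → ℝ) {S K : Finset V} (h : S ⊆ K)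
    (c : ∀ γ, I γ) :
    marginal p S c = ∑ x ∈ cellsOn b K with restr b S x = restr b S c, marginal p K x := by
  have := sum_mul_restr (b := b) p (fun x => if restr b S x = restr b S c then 1 else 0) K
  simp only [restr_restr_of_subset h, mul_ite, mul_one, mul_zero] at this
  rw [Finset.sum_filter, ← this, marginal_eq b, Finset.sum_filter]

/-- Gluing: the cells on `H ∪ C` over a cell on `H` are the cells on `C` which agree with it
on `C ∩ H`. -/
theorem sum_fiber_glue (H C : Finset V) (φ : (∀ γ, I γ) → ℝ) (u : ∀ γ, I γ) :
    ∑ x ∈ cellsOn b (H ∪ C) with restr b H x = restr b H u, φ (restr b C x) =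
      ∑ w ∈ cellsOn b C with restr b (C ∩ H) w = restr b (C ∩ H) u, φ w := by
  refine Finset.sum_nbij' (restr b C) (fun w => H.piecewise (restr b H u) w) ?_ ?_ ?_ ?_ ?_
  · intro x hx
    rw [Finset.mem_filter, restr_eq_restr_iff] at hx ⊢
    refine ⟨restr_mem C x, fun γ hγ => ?_⟩
    rw [Finset.mem_inter] at hγ
    rw [restr_apply_mem hγ.1, hx.2 γ hγ.2]
  · intro w hw
    rw [Finset.mem_filter, restr_eq_restr_iff, mem_cellsOn] at hw ⊢
    refine ⟨fun γ hγ => ?_, fun γ hγ => ?_⟩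
    · rw [Finset.mem_union, not_or] at hγ
      rw [Finset.piecewise_eq_of_notMem _ _ _ hγ.1, hw.1 γ hγ.2]
    · rw [Finset.piecewise_eq_of_mem _ _ _ hγ, restr_apply_mem hγ]
  · intro x hx
    rw [Finset.mem_filter, restr_eq_restr_iff, mem_cellsOn] at hx
    funext γ
    by_cases hγ : γ ∈ H
    · rw [Finset.piecewise_eq_of_mem _ _ _ hγ, restr_apply_mem hγ, hx.2 γ hγ]
    · rw [Finset.piecewise_eq_of_notMem _ _ _ hγ]
      by_cases hC : γ ∈ C
      · rw [restr_apply_mem hC]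
      · rw [restr_apply_notMem hC, hx.1 γ (by simp [hγ, hC])]
  · intro w hw
    rw [Finset.mem_filter, restr_eq_restr_iff, mem_cellsOn] at hw
    funext γ
    by_cases hC : γ ∈ C
    · rw [restr_apply_mem hC]
      by_cases hγ : γ ∈ H
      · rw [Finset.piecewise_eq_of_mem _ _ _ hγ, restr_apply_mem hγ,
          hw.2 γ (Finset.mem_inter.2 ⟨hC, hγ⟩)]
      · rw [Finset.piecewise_eq_of_notMem _ _ _ hγ]
    · rw [restr_apply_notMem hC, hw.1 γ hC]
  · intro x _
    rfl

theorem sum_glue (H C : Finset V) (g φ : (∀ γ, I γ) → ℝ) :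
    ∑ x ∈ cellsOn b (H ∪ C), g (restr b H x) * φ (restr b C x) =
      ∑ u ∈ cellsOn b H,
        g u * ∑ w ∈ cellsOn b C with restr b (C ∩ H) w = restr b (C ∩ H) u, φ w := by
  rw [← Finset.sum_fiberwise_of_maps_to (g := restr b H) (t := cellsOn b H)
    fun x _ => restr_mem H x]
  refine Finset.sum_congr rfl fun u hu => ?_
  rw [← sum_fiber_glue, Finset.mul_sum, restr_eq_self hu]
  refine Finset.sum_congr rfl fun x hx => ?_
  rw [(Finset.mem_filter.1 hx).2]

theorem marginal_left_of_factor {p g φ : (∀ γ, I γ) → ℝ} {H C : Finset V}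
    (h : ∀ x, marginal p (H ∪ C) x = g (restr b H x) * φ (restr b C x)) (u : ∀ γ, I γ) :
    marginal p H u = g (restr b H u) *
      ∑ w ∈ cellsOn b C with restr b (C ∩ H) w = restr b (C ∩ H) u, φ w := by
  rw [marginal_eq_sum_marginal (b := b) p (Finset.subset_union_left (s₂ := C)), ← sum_fiber_glue,
    Finset.mul_sum]
  refine Finset.sum_congr rfl fun x hx => ?_
  rw [h, (Finset.mem_filter.1 hx).2]

/-- A table whose `(H ∪ C)`-marginal factorizes satisfies the conditional independence
`p^{H ∪ C} p^{C ∩ H} = p^H p^C`. -/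
theorem marginal_mul_marginal {p g φ : (∀ γ, I γ) → ℝ} {H C : Finset V}
    (h : ∀ x, marginal p (H ∪ C) x = g (restr b H x) * φ (restr b C x)) (x : ∀ γ, I γ) :
    marginal p (H ∪ C) x * marginal p (C ∩ H) x = marginal p H x * marginal p C x := by
  have hH := marginal_left_of_factor h
  have hC := marginal_left_of_factor (p := p) (g := φ) (φ := g) (H := C) (C := H) (b := b)
    fun x => by rw [Finset.union_comm, h, mul_comm]
  have hS : marginal p (C ∩ H) x =
      (∑ w ∈ cellsOn b C with restr b (C ∩ H) w = restr b (C ∩ H) x, φ w) *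
        ∑ u ∈ cellsOn b H with restr b (H ∩ C) u = restr b (H ∩ C) x, g u := by
    rw [marginal_eq_sum_marginal (b := b) p (Finset.inter_subset_right (s₁ := C)),
      Finset.mul_sum, Finset.inter_comm H C]
    refine Finset.sum_congr rfl fun u hu => ?_
    rw [Finset.mem_filter] at hu
    rw [hH, hu.2, restr_eq_self hu.1, mul_comm]
  rw [h, hS, hH, hC]
  ring

/-- The exponential of the sum of the `θ y` over the `y ∈ P` below the cell. -/
noncomputable def expSum (b : ∀ γ, I γ) (P : Finset (∀ γ, I γ)) (θ : (∀ γ, I γ) → ℝ)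
    (x : ∀ γ, I γ) : ℝ :=
  Real.exp (∑ y ∈ P with Below b y x, θ y)

theorem expSum_pos (P : Finset (∀ γ, I γ)) (θ : (∀ γ, I γ) → ℝ) (x : ∀ γ, I γ) :
    0 < expSum b P θ x := Real.exp_pos _

theorem expSum_restr {P : Finset (∀ γ, I γ)} {K : Finset V} (hP : P ⊆ cellsOn b K)
    (θ : (∀ γ, I γ) → ℝ) (x : ∀ γ, I γ) : expSum b P θ (restr b K x) = expSum b P θ x := by
  unfold expSum
  congr 2
  refine Finset.filter_congr fun y hy => ?_
  rw [below_restr_iff]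
  exact and_iff_right (hP hy)

theorem expSum_union {P N : Finset (∀ γ, I γ)} (h : Disjoint P N)
    (θ : (∀ γ, I γ) → ℝ) (x : ∀ γ, I γ) :
    expSum b (P ∪ N) θ x = expSum b P θ x * expSum b N θ x := by
  rw [expSum, Finset.filter_union, Finset.sum_union (Finset.disjoint_filter_filter h), Real.exp_add]
  rfl

/-- The parameters on the cells on `S` whose sums below a cell `x` are `L (x_S)`. -/
noncomputable def shift (b : ∀ γ, I γ) (S : Finset V) (L : (∀ γ, I γ) → ℝ) (y : ∀ γ, I γ) : ℝ :=
  if y ∈ cellsOn b S then mobiusTransform b L y else 0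

theorem sum_shift {S : Finset V} {P : Finset (∀ γ, I γ)} (hS : cellsOn b S ⊆ P)
    (L : (∀ γ, I γ) → ℝ) (x : ∀ γ, I γ) :
    ∑ y ∈ P with Below b y x, shift b S L y = L (restr b S x) := by
  rw [← sum_cellsOn_mobiusTransform S L, Finset.sum_filter, Finset.sum_filter]
  rw [← Finset.sum_subset hS fun y _ hy => by simp only [shift, if_neg hy, ite_self]]
  exact Finset.sum_congr rfl fun y hy => by simp only [shift, if_pos hy]

theorem expSum_add_shift {S : Finset V} {P : Finset (∀ γ, I γ)} (hS : cellsOn b S ⊆ P)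
    (θ L : (∀ γ, I γ) → ℝ) (x : ∀ γ, I γ) :
    expSum b P (θ + shift b S L) x = expSum b P θ x * Real.exp (L (restr b S x)) := by
  rw [expSum, ← sum_shift hS L, expSum, ← Real.exp_add, ← Finset.sum_add_distrib]
  rfl

theorem sum_shift_mul {S : Finset V} {P : Finset (∀ γ, I γ)} (hS : cellsOn b S ⊆ P)
    (L s : (∀ γ, I γ) → ℝ) :
    ∑ y ∈ P, shift b S L y * s y = ∑ z ∈ cellsOn b S, cellHyper b s S z * L z := by
  rw [← sum_mobiusTransform_mul,
    ← Finset.sum_subset hS fun y _ hy => by simp only [shift, if_neg hy, zero_mul]]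
  exact Finset.sum_congr rfl fun y hy => by simp only [shift, if_pos hy]

/-- The cells on `C` which are not cells on `S`. -/
def newCells (b : ∀ γ, I γ) (C S : Finset V) : Finset (∀ γ, I γ) := cellsOn b C \ cellsOn b S

theorem newCells_subset (C S : Finset V) : newCells b C S ⊆ cellsOn b C := Finset.sdiff_subset

theorem cellsOn_inter (C H : Finset V) : cellsOn b (C ∩ H) = cellsOn b C ∩ cellsOn b H := by
  ext x
  simp only [mem_cellsOn_iff_support, Finset.mem_inter, Finset.subset_inter_iff]

theorem disjoint_newCells {P : Finset (∀ γ, I γ)} {C H : Finset V} (hP : P ⊆ cellsOn b H) :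
    Disjoint P (newCells b C (C ∩ H)) := by
  rw [Finset.disjoint_left]
  intro x hx hx'
  rw [newCells, cellsOn_inter, Finset.mem_sdiff, Finset.mem_inter] at hx'
  exact hx'.2 ⟨hx'.1, hP hx⟩

theorem union_newCells {P : Finset (∀ γ, I γ)} {C H : Finset V}
    (hS : cellsOn b (C ∩ H) ⊆ P) : P ∪ newCells b C (C ∩ H) = P ∪ cellsOn b C := by
  ext x
  simp only [Finset.mem_union, newCells, Finset.mem_sdiff]
  constructor
  · tauto
  · rintro (h | h)
    · exact Or.inl h
    · by_cases h' : x ∈ cellsOn b (C ∩ H)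
      · exact Or.inl (hS h')
      · exact Or.inr ⟨h, h'⟩

/-- The sum, over the cells on `C` which lie over a cell on `S`, of the exponentials of the sums of
the new parameters. -/
noncomputable def fiberSum (b : ∀ γ, I γ) (C S : Finset V) (θ : (∀ γ, I γ) → ℝ)
    (z : ∀ γ, I γ) : ℝ :=
  ∑ w ∈ cellsOn b C with restr b S w = restr b S z, expSum b (newCells b C S) θ w

theorem fiberSum_pos {C S : Finset V} (h : S ⊆ C) (θ : (∀ γ, I γ) → ℝ) (z : ∀ γ, I γ) :
    0 < fiberSum b C S θ z :=
  Finset.sum_pos (fun _ _ => expSum_pos _ _ _)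
    ⟨restr b C z, Finset.mem_filter.2 ⟨restr_mem C z, restr_restr_of_subset h z⟩⟩

theorem fiberSum_restr (C S : Finset V) (θ : (∀ γ, I γ) → ℝ) (z : ∀ γ, I γ) :
    fiberSum b C S θ (restr b S z) = fiberSum b C S θ z := by
  unfold fiberSum
  rw [restr_restr_of_subset subset_rfl]

/-- The old parameters see only `x_H` and the new ones only `x_C`. Those on the separator are
counted among the old ones, which is why `P` must contain all cells on `C ∩ H`. -/
theorem expSum_factor {P : Finset (∀ γ, I γ)} {H C : Finset V} (hP : P ⊆ cellsOn b H)
    (hS : cellsOn b (C ∩ H) ⊆ P) (θ : (∀ γ, I γ) → ℝ) (x : ∀ γ, I γ) :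
    expSum b (P ∪ cellsOn b C) θ x =
      expSum b P θ (restr b H x) * expSum b (newCells b C (C ∩ H)) θ (restr b C x) := by
  rw [← union_newCells hS, expSum_union (disjoint_newCells hP), expSum_restr hP,
    expSum_restr (newCells_subset C _)]

/-- The fibre sum depends on the `S`-cell only, so its logarithm is a sum of parameters on `S` below
`x`. -/
theorem expSum_mul_fiberSum {P : Finset (∀ γ, I γ)} {H C : Finset V}
    (hS : cellsOn b (C ∩ H) ⊆ P) (θ : (∀ γ, I γ) → ℝ) (x : ∀ γ, I γ) :
    expSum b P θ x * fiberSum b C (C ∩ H) θ x =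
      expSum b P (θ + shift b (C ∩ H) fun z => Real.log (fiberSum b C (C ∩ H) θ z)) x := by
  rw [expSum_add_shift hS, fiberSum_restr, Real.exp_log (fiberSum_pos Finset.inter_subset_left θ x)]

/-- Summing out `C \ H` leaves a table with the same parameter set `P`: the factor so produced is
absorbed by a shift on the separator. -/
theorem exists_expSum_marginal {p : (∀ γ, I γ) → ℝ} {P : Finset (∀ γ, I γ)} {H C : Finset V}
    (hP : P ⊆ cellsOn b H) (hS : cellsOn b (C ∩ H) ⊆ P) {θ : (∀ γ, I γ) → ℝ}
    (h : ∀ x, marginal p (H ∪ C) x = expSum b (P ∪ cellsOn b C) θ x) :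
    ∃ θ', ∀ x, marginal p H x = expSum b P θ' x := by
  refine ⟨θ + shift b (C ∩ H) fun z => Real.log (fiberSum b C (C ∩ H) θ z), fun x => ?_⟩
  rw [marginal_left_of_factor fun x => (h x).trans (expSum_factor hP hS θ x), expSum_restr hP,
    ← expSum_mul_fiberSum hS]
  rfl

end Marginals

/-! ### Determinants of second-moment matrices of the indicators. -/

section Moments

variable {V : Type*} [Fintype V] [DecidableEq V] {I : V → Type*} [∀ γ, Fintype (I γ)]
  [∀ γ, DecidableEq (I γ)] {b : ∀ γ, I γ}

/-- The indicator of the cells above `y`. -/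
noncomputable def above (b y x : ∀ γ, I γ) : ℝ := if Below b y x then 1 else 0

theorem above_restr {K : Finset V} {y : ∀ γ, I γ} (hy : y ∈ cellsOn b K) (x : ∀ γ, I γ) :
    above b y (restr b K x) = above b y x := by
  simp only [above, below_restr_iff, hy, true_and]

/-- The second moments of the indicators `above`. -/
noncomputable def moment (b : ∀ γ, I γ) (p : (∀ γ, I γ) → ℝ) (y y' : ∀ γ, I γ) : ℝ :=
  ∑ x, p x * (above b y x * above b y' x)

/-- The matrix of the second moments of the indicators `above` indexed by `P`. -/
noncomputable def momentMatrix (b : ∀ γ, I γ) (p : (∀ γ, I γ) → ℝ) (P : Finset (∀ γ, I γ)) :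
    Matrix P P ℝ :=
  Matrix.of fun y y' => moment b p y y'

theorem sum_mul_above (P : Finset (∀ γ, I γ)) (f : (∀ γ, I γ) → ℝ) (x : ∀ γ, I γ) :
    ∑ y ∈ P, f y * above b y x = ∑ y ∈ P with Below b y x, f y := by
  rw [Finset.sum_filter]
  exact Finset.sum_congr rfl fun y _ => by unfold above; split_ifs <;> simp

/-- With all cells on `K` available, the moment matrix is `T * diag(p^K) * Tᵀ`, where `T` is the
unitriangular matrix of the order. -/
theorem det_momentMatrix_cellsOn (p : (∀ γ, I γ) → ℝ) (K : Finset V) :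
    (momentMatrix b p (cellsOn b K)).det = ∏ z ∈ cellsOn b K, marginal p K z := by
  let T : Matrix (cellsOn b K) (cellsOn b K) ℝ := Matrix.of fun y z => above b y.1 z.1
  have hT : T.det = 1 := by
    refine det_eq_one_of_graded T (fun y => (support b y.1).card)
      (fun y => by simp [T, above]) fun y z h hne => ?_
    have hb : Below b y.1 z.1 := by
      by_contra h'
      exact h (by simp only [T, Matrix.of_apply, above, if_neg h'])
    by_contra hc
    exact hne (Subtype.ext (hb.eq_of_card_le (not_lt.1 hc)))
  have hM : momentMatrix b p (cellsOn b K) =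
      T * Matrix.diagonal (fun z : cellsOn b K => marginal p K z.1) * T.transpose := by
    ext y y'
    rw [Matrix.mul_apply]
    simp only [Matrix.mul_diagonal, Matrix.transpose_apply, T, Matrix.of_apply, momentMatrix,
      moment]
    have h := sum_mul_restr (b := b) p (fun x => above b y.1 x * above b y'.1 x) K
    simp only [above_restr y.2, above_restr y'.2] at h
    rw [h, ← Finset.sum_coe_sort]
    exact Finset.sum_congr rfl fun z _ => by ring
  rw [hM, Matrix.det_mul, Matrix.det_mul, Matrix.det_transpose, hT, Matrix.det_diagonal,
    Finset.prod_coe_sort (cellsOn b K) (marginal p K)]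
  ring

/-- The conditional probability of the cells above `y` given the `S`-cell. -/
noncomputable def condAbove (b : ∀ γ, I γ) (p : (∀ γ, I γ) → ℝ) (C S : Finset V)
    (y z : ∀ γ, I γ) : ℝ :=
  (∑ w ∈ cellsOn b C with restr b S w = restr b S z, marginal p C w * above b y w) /
    marginal p S z

/-- The second moments of the residuals of the indicators `above` given the `S`-cell. -/
noncomputable def residualMatrix (b : ∀ γ, I γ) (p : (∀ γ, I γ) → ℝ) (C S : Finset V) :
    Matrix (newCells b C S) (newCells b C S) ℝ :=
  Matrix.of fun y y' => moment b p y y' -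
    ∑ v ∈ cellsOn b S, moment b p y v * shift b S (condAbove b p C S y') v

/-- The normal equations of the regression of the indicator above `y` on those indexed by `P`. By
conditional independence its conditional expectation given the history depends on the `S`-cell only,
hence expands in the indicators on `S` with the coefficients `shift`. -/
theorem sum_moment_mul_shift {p : (∀ γ, I γ) → ℝ} {P : Finset (∀ γ, I γ)} {H C : Finset V}
    (hp : ∀ i, 0 < p i) (hP : P ⊆ cellsOn b H) (hS : cellsOn b (C ∩ H) ⊆ P)
    (hCI : ∀ x, marginal p (H ∪ C) x * marginal p (C ∩ H) x = marginal p H x * marginal p C x)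
    {v y : ∀ γ, I γ} (hv : v ∈ P) (hy : y ∈ cellsOn b C) :
    ∑ v' ∈ P, moment b p v v' * shift b (C ∩ H) (condAbove b p C (C ∩ H) y) v' =
      moment b p v y := by
  have hSH : C ∩ H ⊆ H := Finset.inter_subset_right
  have hSC : C ∩ H ⊆ C := Finset.inter_subset_left
  have hcond : ∀ x, condAbove b p C (C ∩ H) y (restr b (C ∩ H) x) =
      condAbove b p C (C ∩ H) y x := by
    intro x
    unfold condAbove
    rw [restr_restr_of_subset subset_rfl, marginal_restr p subset_rfl]
  have h1 : ∑ v' ∈ P, moment b p v v' * shift b (C ∩ H) (condAbove b p C (C ∩ H) y) v' =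
      ∑ x, p x * (above b v (restr b H x) * condAbove b p C (C ∩ H) y (restr b H x)) := by
    simp only [moment, Finset.sum_mul]
    rw [Finset.sum_comm]
    refine Finset.sum_congr rfl fun x _ => ?_
    rw [above_restr (hP hv), ← hcond (restr b H x), restr_restr_of_subset hSH,
      ← sum_shift hS (condAbove b p C (C ∩ H) y),
      ← sum_mul_above, Finset.mul_sum, Finset.mul_sum]
    exact Finset.sum_congr rfl fun _ _ => by ring
  have h2 : moment b p v y = ∑ x ∈ cellsOn b (H ∪ C),
      (marginal p H (restr b H x) * above b v (restr b H x) / marginal p (C ∩ H) (restr b H x)) *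
        (marginal p C (restr b C x) * above b y (restr b C x)) := by
    have h := sum_mul_restr (b := b) p (fun x => above b v x * above b y x) (H ∪ C)
    have hv' := cellsOn_mono (b := b) (Finset.subset_union_left (s₁ := H) (s₂ := C)) (hP hv)
    have hy' := cellsOn_mono (b := b) (Finset.subset_union_right (s₁ := H) (s₂ := C)) hy
    simp only [above_restr hv', above_restr hy'] at h
    rw [moment, h]
    refine Finset.sum_congr rfl fun x _ => ?_
    rw [above_restr (hP hv), above_restr hy, marginal_restr p subset_rfl,
      marginal_restr p subset_rfl, marginal_restr p hSH]
    have hpos := marginal_pos hp (C ∩ H) x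
    have := hCI x
    rw [div_mul_eq_mul_div, eq_div_iff hpos.ne']
    linear_combination (above b v x * above b y x) * this
  rw [h1, h2, sum_mul_restr p (fun u => above b v u * condAbove b p C (C ∩ H) y u) H,
    sum_glue H C (fun u => marginal p H u * above b v u / marginal p (C ∩ H) u)
      (fun w => marginal p C w * above b y w)]
  refine Finset.sum_congr rfl fun u _ => ?_
  unfold condAbove
  ring

/-- A Schur complement for an off-diagonal block given as `A * W`; no invertibility of `A` is
needed. -/
theorem det_fromBlocks_mul {m n : Type*} [Fintype m] [DecidableEq m] [Fintype n] [DecidableEq n]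
    (A : Matrix m m ℝ) (W : Matrix m n ℝ) (B : Matrix n m ℝ) (D : Matrix n n ℝ) :
    (Matrix.fromBlocks A (A * W) B D).det = A.det * (D - B * W).det := by
  have : Matrix.fromBlocks A (A * W) B D =
      Matrix.fromBlocks A 0 B (D - B * W) * Matrix.fromBlocks 1 W 0 1 := by
    rw [Matrix.fromBlocks_multiply]
    simp
  rw [this, Matrix.det_mul, Matrix.det_fromBlocks_zero₁₂, Matrix.det_fromBlocks_zero₂₁]
  simp

/-- The Schur complement is the matrix of residual moments, which involves only `C` and the
separator and not the rest of the history. -/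
theorem det_momentMatrix_union {p : (∀ γ, I γ) → ℝ} {P : Finset (∀ γ, I γ)} {H C : Finset V}
    (hp : ∀ i, 0 < p i) (hP : P ⊆ cellsOn b H) (hS : cellsOn b (C ∩ H) ⊆ P)
    (hCI : ∀ x, marginal p (H ∪ C) x * marginal p (C ∩ H) x = marginal p H x * marginal p C x) :
    (momentMatrix b p (P ∪ cellsOn b C)).det =
      (momentMatrix b p P).det * (residualMatrix b p C (C ∩ H)).det := by
  rw [← union_newCells hS]
  let N := newCells b C (C ∩ H)
  let W : Matrix P N ℝ := Matrix.of fun v y => shift b (C ∩ H) (condAbove b p C (C ∩ H) y.1) v.1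
  let B : Matrix N P ℝ := Matrix.of fun y v => moment b p y.1 v.1
  have h1 : (momentMatrix b p (P ∪ N)).submatrix
      (Equiv.Finset.union P N (disjoint_newCells hP))
      (Equiv.Finset.union P N (disjoint_newCells hP)) =
      Matrix.fromBlocks (momentMatrix b p P) (momentMatrix b p P * W) B (momentMatrix b p N) := by
    ext i j
    rcases i with i | i <;> rcases j with j | j
    · rfl
    · rw [Matrix.fromBlocks_apply₁₂, Matrix.mul_apply]
      have := sum_moment_mul_shift hp hP hS hCI i.2 (newCells_subset C _ j.2)
      rw [← Finset.sum_coe_sort] at this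
      exact this.symm
    · rfl
    · rfl
  have h2 : momentMatrix b p N - B * W = residualMatrix b p C (C ∩ H) := by
    ext i j
    rw [Matrix.sub_apply, Matrix.mul_apply]
    simp only [momentMatrix, residualMatrix, B, W, Matrix.of_apply]
    rw [Finset.sum_coe_sort P fun v => moment b p i.1 v *
      shift b (C ∩ H) (condAbove b p C (C ∩ H) j.1) v,
      ← Finset.sum_subset hS fun v _ hv => by simp only [shift, if_neg hv, mul_zero]]
  rw [← Matrix.det_submatrix_equiv_self (Equiv.Finset.union P N (disjoint_newCells hP)), h1,
    det_fromBlocks_mul, h2]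

theorem det_momentMatrix_mul {p : (∀ γ, I γ) → ℝ} {P : Finset (∀ γ, I γ)} {H C : Finset V}
    (hp : ∀ i, 0 < p i) (hP : P ⊆ cellsOn b H) (hS : cellsOn b (C ∩ H) ⊆ P)
    (hCI : ∀ x, marginal p (H ∪ C) x * marginal p (C ∩ H) x = marginal p H x * marginal p C x) :
    (momentMatrix b p (P ∪ cellsOn b C)).det * (momentMatrix b p (cellsOn b (C ∩ H))).det =
      (momentMatrix b p P).det * (momentMatrix b p (cellsOn b C)).det := by
  have hCS : C ∩ (C ∩ H) = C ∩ H := by rw [← Finset.inter_assoc, Finset.inter_self]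
  have hSC : C ∩ H ∪ C = C := Finset.union_eq_right.2 Finset.inter_subset_left
  -- The same residual matrix arises when the history is the separator alone, which expresses its
  -- determinant through complete sets.
  have h := det_momentMatrix_union (b := b) (P := cellsOn b (C ∩ H)) (H := C ∩ H) (C := C) hp
    subset_rfl (by rw [hCS]) (fun x => by rw [hCS, hSC, mul_comm])
  rw [Finset.union_eq_right.2 (cellsOn_mono Finset.inter_subset_left), hCS] at h
  rw [det_momentMatrix_union hp hP hS hCI, h]
  ring

end Moments

/-! ### Normalizing constants of the Poisson weights. -/

section Integrals

variable {V : Type*} [Fintype V] [DecidableEq V] {I : V → Type*} [∀ γ, Fintype (I γ)]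
  [∀ γ, DecidableEq (I γ)] {b : ∀ γ, I γ}

/-- The conjugate weight of a family of independent Poisson counts indexed by the cells on `H`, with
log-linear parameters indexed by `P`. -/
noncomputable def poissonWeight (b : ∀ γ, I γ) (s : (∀ γ, I γ) → ℝ) (P : Finset (∀ γ, I γ))
    (H : Finset V) (θ : (∀ γ, I γ) → ℝ) : ENNReal :=
  ENNReal.ofReal (Real.exp (∑ y ∈ P, θ y * s y - ∑ x ∈ cellsOn b H, expSum b P θ x))

/-- The normalizing constant of `poissonWeight`. -/
noncomputable def poissonConst (b : ∀ γ, I γ) (s : (∀ γ, I γ) → ℝ) (P : Finset (∀ γ, I γ))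
    (H : Finset V) : ENNReal :=
  (∫⋯∫⁻_P, poissonWeight b s P H ∂fun _ => volume) 0

theorem expSum_congr {P : Finset (∀ γ, I γ)} {θ θ' : (∀ γ, I γ) → ℝ} (h : ∀ y ∈ P, θ y = θ' y)
    (x : ∀ γ, I γ) : expSum b P θ x = expSum b P θ' x := by
  unfold expSum
  rw [Finset.sum_congr rfl fun y hy => h y (Finset.mem_filter.1 hy).1]

theorem poissonWeight_congr (s : (∀ γ, I γ) → ℝ) {P : Finset (∀ γ, I γ)} (H : Finset V)
    {θ θ' : (∀ γ, I γ) → ℝ} (h : ∀ y ∈ P, θ y = θ' y) :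
    poissonWeight b s P H θ = poissonWeight b s P H θ' := by
  unfold poissonWeight
  rw [Finset.sum_congr rfl fun y hy => by rw [h y hy],
    Finset.sum_congr (s₁ := cellsOn b H) rfl fun x _ => expSum_congr h x]

@[fun_prop]
theorem continuous_expSum (P : Finset (∀ γ, I γ)) (x : ∀ γ, I γ) :
    Continuous fun θ => expSum b P θ x := by
  unfold expSum
  fun_prop

theorem measurable_poissonWeight (s : (∀ γ, I γ) → ℝ) (P : Finset (∀ γ, I γ)) (H : Finset V) :
    Measurable (poissonWeight b s P H) := by
  unfold poissonWeight
  refine ENNReal.measurable_ofReal.comp (Continuous.measurable ?_)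
  fun_prop

theorem lmarginal_poissonWeight (s : (∀ γ, I γ) → ℝ) (P : Finset (∀ γ, I γ)) (H : Finset V)
    (θ : (∀ γ, I γ) → ℝ) :
    (∫⋯∫⁻_P, poissonWeight b s P H ∂fun _ => volume) θ = poissonConst b s P H := by
  unfold poissonConst lmarginal
  refine lintegral_congr fun y => poissonWeight_congr s H fun i hi => ?_
  simp [Function.updateFinset, hi]

/-- The conjugate weight of the new parameters on `C` given those on `S`. -/
noncomputable def fiberWeight (b : ∀ γ, I γ) (s : (∀ γ, I γ) → ℝ) (C S : Finset V)
    (θ : (∀ γ, I γ) → ℝ) : ENNReal :=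
  ENNReal.ofReal (Real.exp (∑ y ∈ newCells b C S, θ y * s y -
    ∑ z ∈ cellsOn b S, cellHyper b s S z * Real.log (fiberSum b C S θ z)))

theorem fiberSum_congr {C S : Finset V} {θ θ' : (∀ γ, I γ) → ℝ}
    (h : ∀ y ∈ newCells b C S, θ y = θ' y) (z : ∀ γ, I γ) :
    fiberSum b C S θ z = fiberSum b C S θ' z := by
  unfold fiberSum
  exact Finset.sum_congr rfl fun w _ => expSum_congr h w

theorem fiberWeight_congr (s : (∀ γ, I γ) → ℝ) {C S : Finset V} {θ θ' : (∀ γ, I γ) → ℝ}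
    (h : ∀ y ∈ newCells b C S, θ y = θ' y) : fiberWeight b s C S θ = fiberWeight b s C S θ' := by
  unfold fiberWeight
  simp only [fiberSum_congr h]
  rw [Finset.sum_congr rfl fun y hy => by rw [h y hy]]

theorem measurable_fiberWeight (s : (∀ γ, I γ) → ℝ) (C S : Finset V) :
    Measurable (fiberWeight b s C S) := by
  unfold fiberWeight
  have h : ∀ z, Measurable fun θ => fiberSum b C S θ z := by
    intro z
    unfold fiberSum
    refine Continuous.measurable ?_
    fun_prop
  refine ENNReal.measurable_ofReal.comp (Real.measurable_exp.comp (Measurable.sub ?_ ?_))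
  · fun_prop
  · exact Finset.measurable_sum _ fun z _ => (Real.measurable_log.comp (h z)).const_mul _

/-- The total mean over `H ∪ C` is the total mean over `H` at shifted parameters. Rewriting the
linear term in the shifted parameters costs `α^S` against the logarithms of the fibre sums; that
correction is part of `fiberWeight`. -/
theorem poissonWeight_union (s : (∀ γ, I γ) → ℝ) {P : Finset (∀ γ, I γ)} {H C : Finset V}
    (hP : P ⊆ cellsOn b H) (hS : cellsOn b (C ∩ H) ⊆ P) (θ : (∀ γ, I γ) → ℝ) :
    poissonWeight b s (P ∪ cellsOn b C) (H ∪ C) θ = fiberWeight b s C (C ∩ H) θ *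
      poissonWeight b s P H
        (θ + shift b (C ∩ H) fun z => Real.log (fiberSum b C (C ∩ H) θ z)) := by
  set L : (∀ γ, I γ) → ℝ := fun z => Real.log (fiberSum b C (C ∩ H) θ z)
  have h1 : ∑ x ∈ cellsOn b (H ∪ C), expSum b (P ∪ cellsOn b C) θ x =
      ∑ u ∈ cellsOn b H, expSum b P (θ + shift b (C ∩ H) L) u := by
    simp only [expSum_factor hP hS]
    rw [sum_glue H C (expSum b P θ) (expSum b (newCells b C (C ∩ H)) θ)]
    exact Finset.sum_congr rfl fun u _ => expSum_mul_fiberSum hS θ u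
  have h2 : ∑ y ∈ P, (θ + shift b (C ∩ H) L) y * s y =
      ∑ y ∈ P, θ y * s y + ∑ z ∈ cellsOn b (C ∩ H), cellHyper b s (C ∩ H) z * L z := by
    rw [← sum_shift_mul hS L s, ← Finset.sum_add_distrib]
    exact Finset.sum_congr rfl fun y _ => add_mul _ _ _
  have h3 : ∑ y ∈ P ∪ cellsOn b C, θ y * s y =
      ∑ y ∈ P, θ y * s y + ∑ y ∈ newCells b C (C ∩ H), θ y * s y := by
    rw [← union_newCells hS, Finset.sum_union (disjoint_newCells hP)]
  unfold poissonWeight fiberWeight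
  rw [← ENNReal.ofReal_mul (Real.exp_nonneg _), ← Real.exp_add, h1, h2, h3]
  congr 2
  ring

theorem poissonConst_union (s : (∀ γ, I γ) → ℝ) {P : Finset (∀ γ, I γ)} {H C : Finset V}
    (hP : P ⊆ cellsOn b H) (hS : cellsOn b (C ∩ H) ⊆ P) :
    poissonConst b s (P ∪ cellsOn b C) (H ∪ C) =
      (∫⋯∫⁻_(newCells b C (C ∩ H)), fiberWeight b s C (C ∩ H) ∂fun _ => volume) 0 *
        poissonConst b s P H := by
  have hdisj := disjoint_newCells (C := C) hP
  -- With the new parameters fixed, the shift is a constant translation of the old ones and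
  -- disappears from their integral.
  have key : ∀ θ, (∫⋯∫⁻_P, poissonWeight b s (P ∪ cellsOn b C) (H ∪ C) ∂fun _ => volume) θ =
      fiberWeight b s C (C ∩ H) θ * poissonConst b s P H := by
    intro θ
    rw [lmarginal]
    have hagree : ∀ y : P → ℝ, ∀ i ∈ newCells b C (C ∩ H),
        Function.updateFinset θ P y i = θ i := fun y i hi => by
      simp [Function.updateFinset, Finset.disjoint_right.1 hdisj hi]
    let δ : (∀ γ, I γ) → ℝ :=
      shift b (C ∩ H) fun z => Real.log (fiberSum b C (C ∩ H) θ z)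
    have h1 : ∀ y : P → ℝ, poissonWeight b s (P ∪ cellsOn b C) (H ∪ C)
        (Function.updateFinset θ P y) = fiberWeight b s C (C ∩ H) θ *
          poissonWeight b s P H (Function.updateFinset θ P (y + fun i => δ i.1)) := by
      intro y
      rw [poissonWeight_union s hP hS, fiberWeight_congr s (hagree y)]
      simp only [fiberSum_congr (hagree y)]
      congr 1
      refine poissonWeight_congr s H fun i hi => ?_
      simp [Function.updateFinset, hi, δ]
    simp only [h1]
    have hm : Measurable fun y : P → ℝ =>
        poissonWeight b s P H (Function.updateFinset θ P y) :=
      (measurable_poissonWeight s P H).comp measurable_updateFinset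
    have hm' : Measurable fun y : P → ℝ =>
        poissonWeight b s P H (Function.updateFinset θ P (y + fun i => δ i.1)) :=
      hm.comp (measurable_add_const _)
    rw [lintegral_const_mul _ hm',
      ← lmarginal_poissonWeight s P H θ, lmarginal]
    congr 1
    exact lintegral_add_right_eq_self
      (fun y : P → ℝ => poissonWeight b s P H (Function.updateFinset θ P y)) _
  have hU : poissonConst b s (P ∪ cellsOn b C) (H ∪ C) =
      (∫⋯∫⁻_(P ∪ newCells b C (C ∩ H)), poissonWeight b s (P ∪ cellsOn b C) (H ∪ C)
        ∂fun _ => volume) 0 := by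
    rw [poissonConst, union_newCells hS]
  rw [hU, lmarginal_union' _ _ (measurable_poissonWeight s _ _) hdisj, funext key, lmarginal,
    lmarginal, lintegral_mul_const]
  exact (measurable_fiberWeight s _ _).comp measurable_updateFinset

/-- The integral over the new parameters is common to the histories `H` and `C ∩ H`; comparing the
two eliminates it. -/
theorem poissonConst_mul (s : (∀ γ, I γ) → ℝ) {P : Finset (∀ γ, I γ)} {H C : Finset V}
    (hP : P ⊆ cellsOn b H) (hS : cellsOn b (C ∩ H) ⊆ P) :
    poissonConst b s (P ∪ cellsOn b C) (H ∪ C) *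
        poissonConst b s (cellsOn b (C ∩ H)) (C ∩ H) =
      poissonConst b s P H * poissonConst b s (cellsOn b C) C := by
  have hCS : C ∩ (C ∩ H) = C ∩ H := by rw [← Finset.inter_assoc, Finset.inter_self]
  have hSC : C ∩ H ∪ C = C := Finset.union_eq_right.2 Finset.inter_subset_left
  have h := poissonConst_union (b := b) s (P := cellsOn b (C ∩ H)) (H := C ∩ H) (C := C)
    subset_rfl (by rw [hCS])
  rw [Finset.union_eq_right.2 (cellsOn_mono Finset.inter_subset_left), hCS, hSC] at h
  rw [poissonConst_union s hP hS, h]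
  ring

/-- Euler's integral after the substitution `x = exp η`. -/
theorem hasGammaIntegral {a : ℝ} (ha : 0 < a) :
    Integrable (fun η : ℝ => Real.exp (a * η - Real.exp η)) ∧
      ∫ η : ℝ, Real.exp (a * η - Real.exp η) = Real.Gamma a := by
  have hinj : Set.InjOn Real.exp Set.univ := Real.exp_injective.injOn
  have hd : ∀ x ∈ Set.univ, HasDerivWithinAt Real.exp (Real.exp x) Set.univ x :=
    fun x _ => (Real.hasDerivAt_exp x).hasDerivWithinAt
  have him : Real.exp '' Set.univ = Set.Ioi 0 := by rw [Set.image_univ, Real.range_exp]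
  have hfun : ∀ η : ℝ, |Real.exp η| • (Real.exp (-Real.exp η) * Real.exp η ^ (a - 1)) =
      Real.exp (a * η - Real.exp η) := by
    intro η
    rw [abs_of_pos (Real.exp_pos η), ← Real.exp_mul, smul_eq_mul, ← Real.exp_add, ← Real.exp_add]
    congr 1
    ring
  constructor
  · have h := (integrableOn_image_iff_integrableOn_abs_deriv_smul MeasurableSet.univ hd hinj
      fun x => Real.exp (-x) * x ^ (a - 1)).1 (by
        rw [him]; exact Real.GammaIntegral_convergent ha)
    simp only [hfun, integrableOn_univ] at h
    exact h
  · have h := integral_image_eq_integral_abs_deriv_smul MeasurableSet.univ hd hinj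
      fun x => Real.exp (-x) * x ^ (a - 1)
    simp only [hfun, Measure.restrict_univ] at h
    rw [him] at h
    rw [Real.Gamma_eq_integral ha, h]

theorem lintegral_exp_gamma {a : ℝ} (ha : 0 < a) :
    ∫⁻ η : ℝ, ENNReal.ofReal (Real.exp (a * η - Real.exp η)) = ENNReal.ofReal (Real.Gamma a) := by
  rw [← (hasGammaIntegral ha).2, ofReal_integral_eq_lintegral_ofReal (hasGammaIntegral ha).1
    (Filter.Eventually.of_forall fun _ => Real.exp_nonneg _)]

/-- In the saturated case the logarithms of the Poisson means are themselves coordinates, related to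
`θ` by a unitriangular and hence measure-preserving map. In them the weight is a product of
one-dimensional Gamma integrands with exponents `α^K(z)`. -/
theorem poissonConst_cellsOn (s : (∀ γ, I γ) → ℝ) {K : Finset V}
    (hpos : ∀ z ∈ cellsOn b K, 0 < cellHyper b s K z) :
    poissonConst b s (cellsOn b K) K =
      ENNReal.ofReal (∏ z ∈ cellsOn b K, Real.Gamma (cellHyper b s K z)) := by
  let T : Matrix (cellsOn b K) (cellsOn b K) ℝ := Matrix.of fun z y => above b y.1 z.1
  have hT : T.det = 1 := by
    rw [← Matrix.det_transpose]
    refine det_eq_one_of_graded _ (fun y => (support b y.1).card)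
      (fun y => by simp [T, above]) fun y z h hne => ?_
    have hb : Below b y.1 z.1 := by
      by_contra h'
      exact h (by simp only [T, Matrix.transpose_apply, Matrix.of_apply, above, if_neg h'])
    by_contra hc
    exact hne (Subtype.ext (hb.eq_of_card_le (not_lt.1 hc)))
  have hmap : MeasurePreserving (Matrix.toLin' T) := by
    refine ⟨(Matrix.toLin' T).continuous_of_finiteDimensional.measurable, ?_⟩
    rw [Real.map_matrix_volume_pi_eq_smul_volume_pi (by rw [hT]; exact one_ne_zero), hT]
    simp
  have hw : ∀ y : cellsOn b K → ℝ, poissonWeight b s (cellsOn b K) K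
      (Function.updateFinset 0 (cellsOn b K) y) =
      ENNReal.ofReal (∏ z : cellsOn b K, Real.exp (cellHyper b s K z.1 * Matrix.toLin' T y z -
        Real.exp (Matrix.toLin' T y z))) := by
    intro y
    set θ := Function.updateFinset (0 : (∀ γ, I γ) → ℝ) (cellsOn b K) y with hθ
    have hθy : ∀ i : cellsOn b K, θ i.1 = y i := fun i => by
      rw [hθ, Function.updateFinset, dif_pos i.2]
    have h1 : ∀ z : cellsOn b K, Matrix.toLin' T y z =
        ∑ i ∈ cellsOn b K with Below b i z.1, θ i := by
      intro z
      rw [Matrix.toLin'_apply, Matrix.mulVec, dotProduct, ← sum_mul_above,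
        ← Finset.sum_coe_sort (cellsOn b K)]
      refine Finset.sum_congr rfl fun i _ => ?_
      rw [hθy, mul_comm]
      rfl
    have h2 : ∑ i ∈ cellsOn b K, θ i * s i =
        ∑ z ∈ cellsOn b K, cellHyper b s K z * ∑ i ∈ cellsOn b K with Below b i z, θ i := by
      rw [← sum_mobiusTransform_mul]
      refine Finset.sum_congr rfl fun i hi => ?_
      -- Extending `θ` by zero off the cells on `K` puts the sum in the form that Möbius inversion
      -- undoes.
      have : (fun z => ∑ i ∈ cellsOn b K with Below b i z, θ i) =
          fun z => ∑ i with Below b i z, if i ∈ cellsOn b K then θ i else 0 := by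
        funext z
        rw [Finset.sum_ite, Finset.sum_const_zero, add_zero, Finset.filter_filter]
        exact Finset.sum_congr (by ext; simp [and_comm]) fun _ _ => rfl
      rw [this, mobiusTransform_sum_below, if_pos hi]
    rw [poissonWeight, h2, ← Real.exp_sum, ← Finset.sum_sub_distrib, ← Finset.sum_coe_sort]
    simp only [h1]
    rfl
  rw [poissonConst, lmarginal]
  simp only [hw]
  rw [← volume_pi, hmap.lintegral_comp (f := fun η : cellsOn b K → ℝ => ENNReal.ofReal (∏ z : cellsOn b K,
    Real.exp (cellHyper b s K z.1 * η z - Real.exp (η z)))) (by fun_prop),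
    ← Finset.prod_coe_sort]
  have hG := fun z : cellsOn b K => hasGammaIntegral (hpos z.1 z.2)
  rw [← Finset.prod_congr rfl fun z _ => (hG z).2, volume_pi,
    ← integral_fintype_prod_eq_prod fun (z : cellsOn b K) (η : ℝ) =>
      Real.exp (cellHyper b s K z.1 * η - Real.exp η), ofReal_integral_eq_lintegral_ofReal]
  · exact Integrable.fintype_prod fun z => (hG z).1
  · exact Filter.Eventually.of_forall fun _ => Finset.prod_nonneg fun _ _ => Real.exp_nonneg _

end Integrals

/-! ### The dictionary between parameter indices and complete cells, and the exponential form of the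
model. -/

section Params

variable {V : Type*} [Fintype V] [DecidableEq V] {I : V → Type*} [∀ γ, Fintype (I γ)]
  [∀ γ, DecidableEq (I γ)] {G : SimpleGraph V} [DecidableRel G.Adj] {b : ∀ γ, I γ}

theorem support_extend {E : Finset V} (c : StarCell b E) : support b (extend b c) = E := by
  ext γ
  rw [mem_support, extend]
  by_cases h : γ ∈ E
  · simpa [h] using (c ⟨γ, h⟩).2
  · simp [h]

theorem extend_apply_coe {E : Finset V} (c : StarCell b E) (γ : E) : extend b c γ = c γ := by
  simp [extend]

theorem extend_injective {E : Finset V} : Function.Injective (extend b : StarCell b E → _) := by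
  intro c c' h
  funext γ
  have := congrFun h γ
  rw [extend_apply_coe, extend_apply_coe] at this
  exact Subtype.ext this

theorem extend_surjective (x : ∀ γ, I γ) : ∃ c : StarCell b (support b x), extend b c = x := by
  refine ⟨fun γ => ⟨x γ, mem_support.1 γ.2⟩, ?_⟩
  funext γ
  rw [extend]
  by_cases h : γ ∈ support b x
  · rw [dif_pos h]
  · rw [dif_neg h]
    rw [mem_support, not_not] at h
    exact h.symm

/-- The cell `(i_D, i^*_{D^c})` of a parameter index `(D, i_D)`. -/
def cell (q : Param G b) : ∀ γ, I γ := extend b q.2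

theorem support_cell (q : Param G b) : support b (cell q) = q.1.1 := support_extend q.2

theorem cell_injective : Function.Injective (cell : Param G b → ∀ γ, I γ) := by
  rintro ⟨D, c⟩ ⟨D', c'⟩ h
  have hD : D = D' := by
    apply Subtype.ext
    have h1 := support_cell (⟨D, c⟩ : Param G b)
    have h2 := support_cell (⟨D', c'⟩ : Param G b)
    rw [h] at h1
    exact h1.symm.trans h2
  subst hD
  exact congrArg (Sigma.mk D) (extend_injective h)

theorem cell_ne (q : Param G b) : cell q ≠ b := by
  intro h
  have h1 := support_cell q
  obtain ⟨γ, hγ⟩ := q.1.2.1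
  rw [h] at h1
  rw [← h1] at hγ
  exact mem_support.1 hγ rfl

variable (G b) in
/-- The cells which differ from the baseline on a complete set. -/
def completeCells : Finset (∀ γ, I γ) :=
  Finset.univ.filter fun x => G.IsClique (support b x : Set V)

theorem mem_completeCells {x : ∀ γ, I γ} :
    x ∈ completeCells G b ↔ G.IsClique (support b x : Set V) := by
  simp [completeCells]

theorem exists_cell {x : ∀ γ, I γ} (hx : x ∈ completeCells G b) (hne : x ≠ b) :
    ∃ q : Param G b, cell q = x := by
  obtain ⟨c, hc⟩ := extend_surjective (b := b) x
  refine ⟨⟨⟨support b x, ?_, mem_completeCells.1 hx⟩, c⟩, hc⟩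
  by_contra h
  rw [Finset.not_nonempty_iff_eq_empty] at h
  apply hne
  funext γ
  by_contra hγ
  exact Finset.notMem_empty γ (h ▸ mem_support.2 hγ)

theorem cell_mem_completeCells (q : Param G b) : cell q ∈ completeCells G b := by
  rw [mem_completeCells, support_cell]
  exact q.1.2.2

theorem cell_mem_cellsOn {q : Param G b} {K : Finset V} : cell q ∈ cellsOn b K ↔ q.1.1 ⊆ K := by
  rw [mem_cellsOn_iff_support, support_cell]

theorem baseline_mem_completeCells : b ∈ completeCells G b := by
  have : support b b = ∅ := by ext; simp
  rw [mem_completeCells, this]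
  simp

theorem completeCells_eq :
    completeCells G b = insert b (Finset.univ.image (cell : Param G b → _)) := by
  ext x
  simp only [Finset.mem_insert, Finset.mem_image, Finset.mem_univ, true_and]
  constructor
  · intro hx
    by_cases h : x = b
    · exact Or.inl h
    · exact Or.inr (exists_cell hx h)
  · rintro (rfl | ⟨q, rfl⟩)
    · exact baseline_mem_completeCells
    · exact cell_mem_completeCells q

theorem cellsOn_subset_completeCells {K : Finset V} (hK : G.IsClique (K : Set V)) :
    cellsOn b K ⊆ completeCells G b := by
  intro x hx
  rw [mem_completeCells]
  exact hK.subset (Finset.coe_subset.2 (mem_cellsOn_iff_support.1 hx))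

theorem cellsOn_eq {K : Finset V} (hK : G.IsClique (K : Set V)) :
    cellsOn b K =
      insert b ((Finset.univ.filter fun q : Param G b => q.1.1 ⊆ K).image cell) := by
  ext x
  simp only [Finset.mem_insert, Finset.mem_image, Finset.mem_filter, Finset.mem_univ, true_and]
  constructor
  · intro hx
    by_cases h : x = b
    · exact Or.inl h
    · obtain ⟨q, rfl⟩ := exists_cell (cellsOn_subset_completeCells hK hx) h
      exact Or.inr ⟨q, cell_mem_cellsOn.1 hx, rfl⟩
  · rintro (rfl | ⟨q, hq, rfl⟩)
    · exact baseline_mem K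
    · exact cell_mem_cellsOn.2 hq

theorem baseline_notMem_image (s : Finset (Param G b)) : b ∉ s.image cell := by
  rw [Finset.mem_image]
  rintro ⟨q, _, h⟩
  exact cell_ne q h

theorem sum_completeCells (f : (∀ γ, I γ) → ℝ) :
    ∑ y ∈ completeCells G b, f y = f b + ∑ q : Param G b, f (cell q) := by
  rw [completeCells_eq, Finset.sum_insert (baseline_notMem_image _),
    Finset.sum_image cell_injective.injOn]

theorem sum_cellsOn {K : Finset V} (hK : G.IsClique (K : Set V)) (f : (∀ γ, I γ) → ℝ) :
    ∑ y ∈ cellsOn b K, f y = f b + ∑ q : Param G b with q.1.1 ⊆ K, f (cell q) := by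
  rw [cellsOn_eq hK, Finset.sum_insert (baseline_notMem_image _),
    Finset.sum_image cell_injective.injOn]

theorem prod_cellsOn {K : Finset V} (hK : G.IsClique (K : Set V)) (f : (∀ γ, I γ) → ℝ) :
    ∏ y ∈ cellsOn b K, f y = f b * ∏ q : Param G b with q.1.1 ⊆ K, f (cell q) := by
  rw [cellsOn_eq hK, Finset.prod_insert (baseline_notMem_image _),
    Finset.prod_image cell_injective.injOn]

/-- The function on cells with value `a` at the baseline and `θ q` at the cell of `q`. -/
noncomputable def withBaseline (a : ℝ) (θ : Param G b → ℝ) (x : ∀ γ, I γ) : ℝ :=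
  if x = b then a else Function.extend cell θ 0 x

@[simp] theorem withBaseline_baseline (a : ℝ) (θ : Param G b → ℝ) : withBaseline a θ b = a :=
  if_pos rfl

@[simp] theorem withBaseline_cell (a : ℝ) (θ : Param G b → ℝ) (q : Param G b) :
    withBaseline a θ (cell q) = θ q := by
  rw [withBaseline, if_neg (cell_ne q), cell_injective.extend_apply]

theorem below_cell_iff {q : Param G b} {i : ∀ γ, I γ} :
    Below b (cell q) i ↔ ∀ γ : q.1.1, (q.2 γ : I γ) = i γ := by
  constructor
  · intro h γ
    have h' := h γ
    rw [cell, extend_apply_coe] at h'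
    exact h'.resolve_left (q.2 γ).2
  · intro h γ
    by_cases hγ : γ ∈ q.1.1
    · right
      rw [← h ⟨γ, hγ⟩]
      exact extend_apply_coe q.2 ⟨γ, hγ⟩
    · left
      rw [cell, extend, dif_neg hγ]

theorem logOdds_eq (θ : Param G b → ℝ) (i : ∀ γ, I γ) :
    logOdds θ i = ∑ q, above b (cell q) i * θ q := by
  rw [logOdds, Finset.sum_filter]
  refine Finset.sum_congr rfl fun q _ => ?_
  simp only [above, below_cell_iff]
  split_ifs <;> simp

theorem sum_withBaseline_below (a : ℝ) (θ : Param G b → ℝ) (i : ∀ γ, I γ) :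
    ∑ y ∈ completeCells G b with Below b y i, withBaseline a θ y = a + logOdds θ i := by
  rw [← sum_mul_above, sum_completeCells, logOdds_eq]
  simp [above, mul_comm]

theorem expSum_completeCells (a : ℝ) (θ : Param G b → ℝ) (i : ∀ γ, I γ) :
    expSum b (completeCells G b) (withBaseline a θ) i = Real.exp (a + logOdds θ i) := by
  rw [expSum, sum_withBaseline_below]

theorem logOdds_baseline (θ : Param G b → ℝ) : logOdds θ b = 0 := by
  rw [logOdds_eq]
  refine Finset.sum_eq_zero fun q _ => ?_
  rw [above, if_neg (fun h => cell_ne q (below_baseline_iff.1 h)), zero_mul]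

theorem partitionFn_eq (θ : Param G b → ℝ) : partitionFn θ = ∑ x, Real.exp (logOdds θ x) := by
  have hfib : ∀ E : Finset V, ∑ c : StarCell b E, Real.exp (logOdds θ (extend b c)) =
      ∑ x with support b x = E, Real.exp (logOdds θ x) := by
    intro E
    refine Finset.sum_bij (fun c _ => extend b c) ?_ ?_ ?_ ?_
    · intro c _
      simp [support_extend]
    · intro c _ c' _ h
      exact extend_injective h
    · intro x hx
      rw [Finset.mem_filter] at hx
      obtain ⟨c, hc⟩ := extend_surjective (b := b) x
      obtain ⟨-, rfl⟩ := hx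
      exact ⟨c, Finset.mem_univ _, hc⟩
    · intro c _
      rfl
  have h0 : ∑ x with support b x = ∅, Real.exp (logOdds θ x) = 1 := by
    have : (Finset.univ.filter fun x => support b x = ∅) = {b} := by
      ext x
      simp [Finset.eq_empty_iff_forall_notMem, funext_iff]
    rw [this, Finset.sum_singleton, logOdds_baseline, Real.exp_zero]
  rw [partitionFn, Finset.sum_congr rfl fun E _ => hfib E,
    ← Finset.sum_fiberwise (s := Finset.univ) (g := support b)
      (f := fun x => Real.exp (logOdds θ x)),
    ← Finset.sum_filter_add_sum_filter_not Finset.univ (fun E : Finset V => E.Nonempty), add_comm]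
  congr 1
  have : (Finset.univ.filter fun E : Finset V => ¬ E.Nonempty) = {∅} := by
    ext E
    simp
  rw [this, Finset.sum_singleton, h0]

theorem partitionFn_pos (θ : Param G b → ℝ) : 0 < partitionFn θ := by
  rw [partitionFn_eq]
  exact Finset.sum_pos (fun _ _ => Real.exp_pos _) ⟨b, Finset.mem_univ b⟩

theorem cellProb_pos (θ : Param G b → ℝ) (i : ∀ γ, I γ) : 0 < cellProb θ i :=
  div_pos (Real.exp_pos _) (partitionFn_pos θ)

theorem sum_cellProb (θ : Param G b → ℝ) : ∑ i, cellProb θ i = 1 := by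
  simp only [cellProb]
  rw [← Finset.sum_div, ← partitionFn_eq, div_self (partitionFn_pos θ).ne']

theorem log_cellProb (θ : Param G b → ℝ) (i : ∀ γ, I γ) :
    Real.log (cellProb θ i) = -Real.log (partitionFn θ) + logOdds θ i := by
  rw [cellProb, Real.log_div (Real.exp_ne_zero _) (partitionFn_pos θ).ne', Real.log_exp]
  ring

/-- The baseline lies below every cell, so its parameter `-log Z` carries the normalization. -/
theorem cellProb_eq_expSum (θ : Param G b → ℝ) (i : ∀ γ, I γ) :
    cellProb θ i =
      expSum b (completeCells G b) (withBaseline (-Real.log (partitionFn θ)) θ) i := by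
  rw [expSum_completeCells, ← log_cellProb, Real.exp_log (cellProb_pos θ i)]

theorem mobiusTransform_log_cellProb (θ : Param G b → ℝ) (y : ∀ γ, I γ) :
    mobiusTransform b (fun x => Real.log (cellProb θ x)) y =
      if y ∈ completeCells G b then withBaseline (-Real.log (partitionFn θ)) θ y else 0 := by
  have : (fun x => Real.log (cellProb θ x)) = fun x => ∑ w with Below b w x,
      if w ∈ completeCells G b then withBaseline (-Real.log (partitionFn θ)) θ w else 0 := by
    funext x
    rw [log_cellProb, ← sum_withBaseline_below, Finset.sum_ite, Finset.sum_const_zero, add_zero,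
      Finset.filter_filter]
    exact Finset.sum_congr (by ext; simp [and_comm]) fun _ _ => rfl
  rw [this, mobiusTransform_sum_below]

theorem cellProb_injective : Function.Injective (cellProb : (Param G b → ℝ) → _) := by
  intro θ θ' h
  funext q
  have h1 := mobiusTransform_log_cellProb θ (cell q)
  have h2 := mobiusTransform_log_cellProb θ' (cell q)
  rw [if_pos (cell_mem_completeCells q), withBaseline_cell] at h1 h2
  rw [← h1, ← h2, h]

theorem interaction_eq (p : (∀ γ, I γ) → ℝ) {E : Finset V} (c : StarCell b E) :
    interaction b p E c = mobiusTransform b (fun x => Real.log (p x)) (extend b c) := by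
  rw [mobiusTransform_eq_sum_powerset, support_extend, interaction]

theorem cellProb_mem_model (θ : Param G b → ℝ) : cellProb θ ∈ model G b := by
  refine ⟨cellProb_pos θ, sum_cellProb θ, fun E _ hE c => ?_⟩
  rw [interaction_eq, mobiusTransform_log_cellProb, if_neg]
  rwa [mem_completeCells, support_extend]

theorem exists_cellProb_eq {p : (∀ γ, I γ) → ℝ} (hp : p ∈ model G b) :
    ∃ θ : Param G b → ℝ, cellProb θ = p := by
  obtain ⟨hpos, hsum, hint⟩ := hp
  set μ := mobiusTransform b fun x => Real.log (p x) with hμ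
  refine ⟨fun q => μ (cell q), ?_⟩
  have hzero : ∀ y ∉ completeCells G b, μ y = 0 := by
    intro y hy
    obtain ⟨c, hc⟩ := extend_surjective (b := b) y
    rw [mem_completeCells] at hy
    rw [hμ, ← hc, ← interaction_eq]
    refine hint _ ?_ hy c
    rw [Finset.nonempty_iff_ne_empty]
    intro h
    rw [h] at hy
    simp at hy
  have hlog : ∀ x, Real.log (p x) = μ b + logOdds (fun q : Param G b => μ (cell q)) x := by
    intro x
    rw [← sum_withBaseline_below, ← sum_below_mobiusTransform (b := b) (fun x => Real.log (p x)) x,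
      ← hμ, Finset.sum_filter, Finset.sum_filter,
      ← Finset.sum_subset (Finset.subset_univ (completeCells G b)) fun y _ hy => by
        rw [hzero y hy, ite_self]]
    refine Finset.sum_congr rfl fun y hy => ?_
    have : withBaseline (μ b) (fun q : Param G b => μ (cell q)) y = μ y := by
      by_cases h : y = b
      · rw [h, withBaseline_baseline]
      · obtain ⟨q, rfl⟩ := exists_cell hy h
        rw [withBaseline_cell]
    rw [this]
  have hexp : ∀ x, p x = Real.exp (μ b) * Real.exp (logOdds (fun q : Param G b => μ (cell q)) x) := by
    intro x
    rw [← Real.exp_add, ← hlog, Real.exp_log (hpos x)]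
  -- Total mass one forces the baseline coefficient `μ b` to be `-log Z`.
  have hZ : Real.exp (μ b) * partitionFn (fun q : Param G b => μ (cell q)) = 1 := by
    rw [partitionFn_eq, Finset.mul_sum, ← hsum]
    exact Finset.sum_congr rfl fun x _ => (hexp x).symm
  funext x
  rw [cellProb, hexp, div_eq_iff (partitionFn_pos _).ne']
  linear_combination (-Real.exp (logOdds (fun q : Param G b => μ (cell q)) x)) * hZ

theorem model_eq_range : model G b = Set.range (cellProb : (Param G b → ℝ) → _) := by
  ext p
  exact ⟨fun hp => exists_cellProb_eq hp, fun ⟨θ, hθ⟩ => hθ ▸ cellProb_mem_model θ⟩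

theorem alphaEmpty_eq (s : Param G b → ℝ) (α : ℝ) {K : Finset V} (hK : G.IsClique (K : Set V)) :
    alphaEmpty s α K = cellHyper b (withBaseline α s) K b := by
  have hb : support b b = ∅ := by ext; simp
  rw [alphaEmpty, cellHyper, sum_cellsOn hK, mobius_self, withBaseline_baseline, one_mul]
  congr 1
  refine Finset.sum_congr rfl fun q _ => ?_
  rw [withBaseline_cell, mobius, if_pos (baseline_below _), hb, Finset.sdiff_empty, support_cell]

theorem alphaCell_eq (s : Param G b → ℝ) (α : ℝ) {K : Finset V} (hK : G.IsClique (K : Set V))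
    (d : Param G b) : alphaCell s K d = cellHyper b (withBaseline α s) K (cell d) := by
  rw [alphaCell, cellHyper, sum_cellsOn hK,
    mobius_of_not_below fun h => cell_ne d (below_baseline_iff.1 h), zero_mul, zero_add,
    Finset.sum_filter, Finset.sum_filter]
  refine Finset.sum_congr rfl fun q _ => ?_
  have hiff : (d.1.1 ⊆ q.1.1 ∧ q.1.1 ⊆ K ∧ ∀ γ ∈ d.1.1, extend b q.2 γ = extend b d.2 γ) ↔
      q.1.1 ⊆ K ∧ Below b (cell d) (cell q) := by
    constructor
    · rintro ⟨-, h2, h3⟩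
      refine ⟨h2, fun γ => ?_⟩
      by_cases hγ : γ ∈ d.1.1
      · exact Or.inr (h3 γ hγ).symm
      · rw [← support_cell d, mem_support, not_not] at hγ
        exact Or.inl hγ
    · rintro ⟨h1, h2⟩
      have := h2.support_subset
      rw [support_cell, support_cell] at this
      refine ⟨this, h1, fun γ hγ => ?_⟩
      rw [← support_cell d, mem_support] at hγ
      exact ((h2 γ).resolve_left hγ).symm
  simp only [hiff, withBaseline_cell, mobius, support_cell]
  by_cases h1 : q.1.1 ⊆ K <;> by_cases h2 : Below b (cell d) (cell q) <;> simp [h1, h2]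

theorem sum_cellsOn_fiber {K : Finset V} (hK : G.IsClique (K : Set V)) (S : Finset V)
    {z : ∀ γ, I γ} (hz : z ∈ cellsOn b S) (f : (∀ γ, I γ) → ℝ) :
    ∑ w ∈ cellsOn b K with restr b S w = z, f w = (if z = b then f b else 0) +
      ∑ q : Param G b with q.1.1 ⊆ K ∧ ∀ γ ∈ S, extend b q.2 γ = z γ, f (cell q) := by
  have hb : restr b S b = b := restr_eq_self (baseline_mem S)
  rw [Finset.sum_filter, sum_cellsOn hK, hb, ← Finset.filter_filter, Finset.sum_filter _
    (fun q : Param G b => f (cell q))]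
  simp only [restr_eq_iff hz, eq_comm (a := b)]
  rfl

theorem gammaProd_eq (s : Param G b → ℝ) (α : ℝ) {K : Finset V} (hK : G.IsClique (K : Set V)) :
    gammaProd K (alphaEmpty s α K) (alphaCell s K) =
      ∏ z ∈ cellsOn b K, Real.Gamma (cellHyper b (withBaseline α s) K z) := by
  rw [gammaProd, prod_cellsOn hK, alphaEmpty_eq s α hK]
  simp only [alphaCell_eq s α hK]

theorem dirichletDensity_eq (s : Param G b → ℝ) (α : ℝ) {K : Finset V}
    (hK : G.IsClique (K : Set V)) (p : (∀ γ, I γ) → ℝ) :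
    dirichletDensity K (alphaEmpty s α K) (alphaCell s K) p =
      Real.Gamma α / (∏ z ∈ cellsOn b K, Real.Gamma (cellHyper b (withBaseline α s) K z)) *
        ∏ z ∈ cellsOn b K, marginal p K z ^ (cellHyper b (withBaseline α s) K z - 1) := by
  have hsum : alphaEmpty s α K + ∑ q : Param G b with q.1.1 ⊆ K, alphaCell s K q = α := by
    simp only [alphaCell_eq s α hK]
    rw [alphaEmpty_eq s α hK, ← sum_cellsOn hK, sum_cellHyper, withBaseline_baseline]
  rw [dirichletDensity, hsum, gammaProd_eq s α hK, prod_cellsOn hK (fun z => marginal p K z ^ _),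
    alphaEmpty_eq s α hK]
  simp only [alphaCell_eq s α hK]
  rfl

theorem hyperConsistent {m : ℕ} {C : Fin (m + 1) → Finset V}
    (hC : ∀ l, G.IsClique (C l : Set V)) (s : Param G b → ℝ) (α : ℝ) :
    HyperConsistent C (alphaEmpty s α) (alphaCell s) := by
  intro l j hlj
  have hS : G.IsClique (sep C l : Set V) := (hC j).subset (Finset.coe_subset.2 hlj)
  have hsum := fun z => cellHyper_restr (b := b) (withBaseline α s) hlj z
  constructor
  · rw [alphaEmpty_eq s α hS, alphaEmpty_eq s α (hC j), hsum,
      sum_cellsOn_fiber (hC j) _ (baseline_mem _), if_pos rfl]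
    simp only [alphaCell_eq s α (hC j)]
  · intro d hd
    rw [alphaCell_eq s α hS, hsum, sum_cellsOn_fiber (hC j) _ (cell_mem_cellsOn.2 hd),
      if_neg (cell_ne d), zero_add]
    simp only [alphaCell_eq s α (hC j)]
    rfl

end Params

/-! ### Telescoping along a perfect ordering. -/

/-- Stated without division so that it serves both real numbers and `ENNReal`. -/
theorem mul_prod_eq_prod_of_chain {M : Type*} [CommMonoid M] {m : ℕ} (D c : Fin (m + 1) → M)
    (σ : Fin m → M) (h0 : D 0 = c 0)
    (hs : ∀ l : Fin m, D l.succ * σ l = D l.castSucc * c l.succ) :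
    D (Fin.last m) * ∏ l, σ l = ∏ l, c l := by
  induction m with
  | zero => simpa using h0
  | succ m ih =>
    have h := ih (fun l => D l.castSucc) (fun l => c l.castSucc) (fun l => σ l.castSucc) h0
      fun l => hs l.castSucc
    rw [Fin.prod_univ_castSucc, Fin.prod_univ_castSucc (f := c), ← h]
    have h' := hs (Fin.last m)
    rw [Fin.succ_last] at h'
    calc D (Fin.last (m + 1)) * ((∏ l : Fin m, σ l.castSucc) * σ (Fin.last m))
        = (D (Fin.last (m + 1)) * σ (Fin.last m)) * ∏ l : Fin m, σ l.castSucc := by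
          rw [mul_comm (∏ l : Fin m, σ l.castSucc), mul_assoc]
      _ = _ := by rw [h', mul_right_comm]

section Ordering

variable {V : Type*} [Fintype V] [DecidableEq V] {I : V → Type*} [∀ γ, Fintype (I γ)]
  [∀ γ, DecidableEq (I γ)] {G : SimpleGraph V} [DecidableRel G.Adj] {b : ∀ γ, I γ}
  {m : ℕ} {C : Fin (m + 1) → Finset V}

/-- The union of the cliques up to the `l`-th one. -/
def history (C : Fin (m + 1) → Finset V) (l : Fin (m + 1)) : Finset V :=
  (Finset.univ.filter fun j => j ≤ l).biUnion C

/-- The cells which differ from the baseline within one of the cliques up to the `l`-th one. -/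
def historyCells (b : ∀ γ, I γ) (C : Fin (m + 1) → Finset V) (l : Fin (m + 1)) :
    Finset (∀ γ, I γ) :=
  (Finset.univ.filter fun j => j ≤ l).biUnion fun j => cellsOn b (C j)

theorem filter_le_zero : (Finset.univ.filter fun j : Fin (m + 1) => j ≤ 0) = {0} := by
  ext j
  simp

theorem filter_le_succ (l : Fin m) : (Finset.univ.filter fun j : Fin (m + 1) => j ≤ l.succ) =
    (Finset.univ.filter fun j => j ≤ l.castSucc) ∪ {l.succ} := by
  ext j
  simp only [Finset.mem_filter, Finset.mem_univ, true_and, Finset.mem_union, Finset.mem_singleton,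
    Fin.le_def, Fin.ext_iff, Fin.val_succ, Fin.val_castSucc]
  omega

theorem history_zero : history C 0 = C 0 := by
  rw [history, filter_le_zero, Finset.singleton_biUnion]

theorem history_succ (l : Fin m) : history C l.succ = history C l.castSucc ∪ C l.succ := by
  rw [history, filter_le_succ, Finset.union_biUnion, Finset.singleton_biUnion]
  rfl

theorem historyCells_zero : historyCells b C 0 = cellsOn b (C 0) := by
  rw [historyCells, filter_le_zero, Finset.singleton_biUnion]

theorem historyCells_succ (l : Fin m) :
    historyCells b C l.succ = historyCells b C l.castSucc ∪ cellsOn b (C l.succ) := by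
  rw [historyCells, filter_le_succ, Finset.union_biUnion, Finset.singleton_biUnion]
  rfl

theorem historyCells_subset (l : Fin (m + 1)) :
    historyCells b C l ⊆ cellsOn b (history C l) :=
  Finset.biUnion_subset.2 fun _ hj => cellsOn_mono (Finset.subset_biUnion_of_mem C hj)

theorem IsPerfectOrdering.isClique (hC : IsPerfectOrdering G C) (l : Fin (m + 1)) :
    G.IsClique (C l : Set V) :=
  ((hC.mem_range_iff (C l)).1 ⟨l, rfl⟩).prop

theorem IsPerfectOrdering.isClique_sep (hC : IsPerfectOrdering G C) (l : Fin m) :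
    G.IsClique (sep C l : Set V) :=
  (hC.isClique l.succ).subset (Finset.coe_subset.2 Finset.inter_subset_left)

theorem IsPerfectOrdering.exists_subset (hC : IsPerfectOrdering G C) {K : Finset V}
    (hK : G.IsClique (K : Set V)) : ∃ l, K ⊆ C l := by
  obtain ⟨K', hle, hmax⟩ := Finite.exists_le_maximal
    (p := fun K' : Finset V => G.IsClique (K' : Set V)) hK
  obtain ⟨l, rfl⟩ := (hC.mem_range_iff K').2 hmax
  exact ⟨l, hle⟩

theorem IsPerfectOrdering.cellsOn_sep_subset (hC : IsPerfectOrdering G C) (l : Fin m) :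
    cellsOn b (sep C l) ⊆ historyCells b C l.castSucc := by
  obtain ⟨j, hj, hsub⟩ := hC.running_intersection l
  exact (cellsOn_mono hsub).trans
    (Finset.subset_biUnion_of_mem (fun j => cellsOn b (C j)) (by simpa using hj))

theorem IsPerfectOrdering.history_last (hC : IsPerfectOrdering G C) :
    history C (Fin.last m) = Finset.univ := by
  ext γ
  obtain ⟨l, hl⟩ := hC.exists_subset (K := {γ}) (by simp)
  simp only [history, Finset.mem_biUnion, Finset.mem_filter, Finset.mem_univ, true_and, iff_true]
  exact ⟨l, Fin.le_last l, hl (Finset.mem_singleton_self γ)⟩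

theorem IsPerfectOrdering.historyCells_last (hC : IsPerfectOrdering G C) :
    historyCells b C (Fin.last m) = completeCells G b := by
  ext x
  simp only [historyCells, Finset.mem_biUnion, Finset.mem_filter, Finset.mem_univ, true_and]
  constructor
  · rintro ⟨j, -, hj⟩
    exact cellsOn_subset_completeCells (hC.isClique j) hj
  · intro hx
    obtain ⟨l, hl⟩ := hC.exists_subset (mem_completeCells.1 hx)
    exact ⟨l, Fin.le_last l, mem_cellsOn_iff_support.2 hl⟩

/-- Downward induction from the full table, removing the last clique each time. The running
intersection property puts the cells on the separator among those of the history, as the shift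
requires. -/
theorem IsPerfectOrdering.exists_marginal_history (hC : IsPerfectOrdering G C)
    {p τ : (∀ γ, I γ) → ℝ} (hp : ∀ x, p x = expSum b (completeCells G b) τ x) (l : Fin (m + 1)) :
    ∃ τ', ∀ x, marginal p (history C l) x = expSum b (historyCells b C l) τ' x := by
  induction l using Fin.reverseInduction with
  | last =>
    refine ⟨τ, fun x => ?_⟩
    rw [hC.history_last, hC.historyCells_last, marginal_univ, hp]
  | cast l ih =>
    obtain ⟨τ', h⟩ := ih
    rw [history_succ, historyCells_succ] at h
    exact exists_expSum_marginal (historyCells_subset _) (hC.cellsOn_sep_subset l) h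

theorem IsPerfectOrdering.marginal_mul_marginal (hC : IsPerfectOrdering G C)
    {p τ : (∀ γ, I γ) → ℝ} (hp : ∀ x, p x = expSum b (completeCells G b) τ x) (l : Fin m)
    (x : ∀ γ, I γ) :
    marginal p (history C l.castSucc ∪ C l.succ) x * marginal p (sep C l) x =
      marginal p (history C l.castSucc) x * marginal p (C l.succ) x := by
  obtain ⟨τ', h⟩ := hC.exists_marginal_history hp l.succ
  rw [history_succ, historyCells_succ] at h
  exact HyperDirichlet.marginal_mul_marginal (fun x =>
    (h x).trans (expSum_factor (historyCells_subset _) (hC.cellsOn_sep_subset l) τ' x)) x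

/-- The factorization of a table of the model of a decomposable graph. -/
theorem IsPerfectOrdering.mul_prod_marginal_sep (hC : IsPerfectOrdering G C)
    {p τ : (∀ γ, I γ) → ℝ} (hp : ∀ x, p x = expSum b (completeCells G b) τ x) (x : ∀ γ, I γ) :
    p x * ∏ l, marginal p (sep C l) x = ∏ l, marginal p (C l) x := by
  have h := mul_prod_eq_prod_of_chain (fun l => marginal p (history C l) x)
    (fun l => marginal p (C l) x) (fun l => marginal p (sep C l) x) (by simp only [history_zero])
    fun l => by rw [history_succ, hC.marginal_mul_marginal hp]
  rwa [hC.history_last, marginal_univ] at h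

/-- This determinant is the Jacobian of the change of coordinates, and so the origin of the `-1` in
the Dirichlet exponents. -/
theorem IsPerfectOrdering.det_momentMatrix_mul (hC : IsPerfectOrdering G C)
    {p τ : (∀ γ, I γ) → ℝ} (hp : ∀ x, p x = expSum b (completeCells G b) τ x) :
    (momentMatrix b p (completeCells G b)).det *
        ∏ l, ∏ z ∈ cellsOn b (sep C l), marginal p (sep C l) z =
      ∏ l, ∏ z ∈ cellsOn b (C l), marginal p (C l) z := by
  have hpos : ∀ x, 0 < p x := fun x => hp x ▸ expSum_pos _ _ _
  simp only [← det_momentMatrix_cellsOn]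
  rw [← hC.historyCells_last]
  refine mul_prod_eq_prod_of_chain (fun l => (momentMatrix b p (historyCells b C l)).det)
    (fun l => (momentMatrix b p (cellsOn b (C l))).det) _ (by rw [historyCells_zero])
    fun l => ?_
  rw [historyCells_succ]
  exact HyperDirichlet.det_momentMatrix_mul hpos (historyCells_subset _) (hC.cellsOn_sep_subset l)
    (hC.marginal_mul_marginal hp l)

theorem IsPerfectOrdering.poissonConst_mul (hC : IsPerfectOrdering G C) (s : (∀ γ, I γ) → ℝ) :
    poissonConst b s (completeCells G b) Finset.univ *
        ∏ l, poissonConst b s (cellsOn b (sep C l)) (sep C l) =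
      ∏ l, poissonConst b s (cellsOn b (C l)) (C l) := by
  rw [← hC.historyCells_last, ← hC.history_last]
  refine mul_prod_eq_prod_of_chain
    (fun l => poissonConst b s (historyCells b C l) (history C l)) _ _
    (by simp only [historyCells_zero, history_zero]) fun l => ?_
  rw [historyCells_succ, history_succ]
  exact HyperDirichlet.poissonConst_mul s (historyCells_subset _) (hC.cellsOn_sep_subset l)

/-- The sufficient statistic against the parameters, in terms of the clique and separator
marginals. -/
theorem IsPerfectOrdering.sum_mobiusTransform_log (hC : IsPerfectOrdering G C)
    {p τ : (∀ γ, I γ) → ℝ} (hp : ∀ x, p x = expSum b (completeCells G b) τ x)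
    (s : (∀ γ, I γ) → ℝ) :
    ∑ y ∈ completeCells G b, mobiusTransform b (fun x => Real.log (p x)) y * s y =
      ∑ l, ∑ z ∈ cellsOn b (C l), cellHyper b s (C l) z * Real.log (marginal p (C l) z) -
        ∑ l, ∑ z ∈ cellsOn b (sep C l),
          cellHyper b s (sep C l) z * Real.log (marginal p (sep C l) z) := by
  have hpos : ∀ x, 0 < p x := fun x => hp x ▸ expSum_pos _ _ _
  have hne : ∀ K x, marginal p K x ≠ 0 := fun K x => (marginal_pos hpos K x).ne'
  have hlog : ∀ x, Real.log (p x) = ∑ l, Real.log (marginal p (C l) x) -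
      ∑ l, Real.log (marginal p (sep C l) x) := by
    intro x
    have h := congrArg Real.log (hC.mul_prod_marginal_sep hp x)
    rw [Real.log_mul (hpos x).ne' (Finset.prod_ne_zero_iff.2 fun l _ => hne _ x),
      Real.log_prod fun l _ => hne _ x, Real.log_prod fun l _ => hne _ x] at h
    linarith
  -- Each logarithm of a marginal is a function of `x_K`, so its transform lives on the cells on `K`
  -- and pairs with `s` through `α^K`.
  have hK : ∀ K : Finset V, G.IsClique (K : Set V) → ∑ y ∈ completeCells G b,
      mobiusTransform b (fun x => Real.log (marginal p K x)) y * s y =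
        ∑ z ∈ cellsOn b K, cellHyper b s K z * Real.log (marginal p K z) := by
    intro K hKc
    rw [← sum_mobiusTransform_mul]
    refine (Finset.sum_subset (cellsOn_subset_completeCells hKc) fun y _ hy => ?_).symm
    rw [mobiusTransform_eq_zero (fun x => by rw [marginal_restr p subset_rfl]) hy, zero_mul]
  rw [← Finset.sum_congr rfl fun l _ => hK (C l) (hC.isClique l),
    ← Finset.sum_congr rfl fun l _ => hK (sep C l) (hC.isClique_sep l), Finset.sum_comm,
    Finset.sum_comm (s := Finset.univ (α := Fin m)), ← Finset.sum_sub_distrib]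
  refine Finset.sum_congr rfl fun y _ => ?_
  rw [← Finset.sum_mul, ← Finset.sum_mul, ← sub_mul]
  congr 1
  simp only [mobiusTransform, hlog, mul_sub, Finset.mul_sum, Finset.sum_sub_distrib]
  rw [Finset.sum_comm, Finset.sum_comm (s := Finset.univ (α := Fin m))]

end Ordering

/-! ### Positivity of the hyperparameters from properness of the prior. -/

/-- An integrable function cannot stay bounded below by a positive function along a direction. -/
theorem not_forall_le_translate {ι : Type*} [Fintype ι] {f g : (ι → ℝ) → ℝ} (hf : Integrable f)
    (hg : Measurable g) (hpos : ∀ θ, 0 < g θ) {u : ι → ℝ} (hu : u ≠ 0) :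
    ¬ ∀ (n : ℕ) (θ : ι → ℝ), g θ ≤ f (θ - (n : ℝ) • u) := by
  intro h
  set B : Set (ι → ℝ) := Metric.ball 0 1
  have hB : MeasurableSet B := measurableSet_ball
  have hc : 0 < ∫⁻ θ in B, ENNReal.ofReal (g θ) := by
    rw [lintegral_pos_iff_support hg.ennreal_ofReal]
    have : Function.support (fun θ => ENNReal.ofReal (g θ)) = Set.univ := by
      ext θ
      simp [hpos θ]
    rw [this, Measure.restrict_apply_univ]
    exact Metric.measure_ball_pos volume 0 one_pos
  -- The integral of `f` over the ball translated by `-n u` is at least the fixed positive integral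
  -- of `g` over the ball.
  have hle : ∀ n : ℕ, ∫⁻ θ in B, ENNReal.ofReal (g θ) ≤
      ∫⁻ θ, B.indicator 1 (θ + (n : ℝ) • u) * ENNReal.ofReal (f θ) := by
    intro n
    rw [← lintegral_sub_right_eq_self (fun θ => B.indicator 1 (θ + (n : ℝ) • u) *
      ENNReal.ofReal (f θ)) ((n : ℝ) • u), ← lintegral_indicator hB]
    refine lintegral_mono fun θ => ?_
    simp only [sub_add_cancel]
    by_cases hθ : θ ∈ B
    · simpa [hθ] using ENNReal.ofReal_le_ofReal (h n θ)
    · simp [hθ]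
  -- The translated balls leave every point, so these integrals tend to zero by domination by `f`.
  have hlim : Filter.Tendsto
      (fun n : ℕ => ∫⁻ θ, B.indicator 1 (θ + (n : ℝ) • u) * ENNReal.ofReal (f θ))
      Filter.atTop (nhds (∫⁻ _ : ι → ℝ, 0)) := by
    refine tendsto_lintegral_of_dominated_convergence' (fun θ => ENNReal.ofReal (f θ)) ?_ ?_ ?_ ?_
    · intro n
      refine AEMeasurable.mul ?_ hf.1.aemeasurable.ennreal_ofReal
      exact ((measurable_one.indicator hB).comp (measurable_add_const _)).aemeasurable
    · intro n
      refine Filter.Eventually.of_forall fun θ => ?_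
      by_cases hθ : θ + (n : ℝ) • u ∈ B <;> simp [hθ]
    · exact hf.lintegral_lt_top.ne
    · refine Filter.Eventually.of_forall fun θ => ?_
      refine tendsto_const_nhds.congr' ?_
      obtain ⟨N, hN⟩ := exists_nat_gt ((1 + ‖θ‖) / ‖u‖)
      filter_upwards [Filter.eventually_ge_atTop N] with n hn
      have hn' : (N : ℝ) ≤ n := Nat.cast_le.2 hn
      have hu' : 0 < ‖u‖ := norm_pos_iff.2 hu
      rw [div_lt_iff₀ hu'] at hN
      have h1 : ‖(n : ℝ) • u‖ ≤ ‖θ + (n : ℝ) • u‖ + ‖θ‖ := by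
        have := norm_sub_le (θ + (n : ℝ) • u) θ
        rwa [add_sub_cancel_left] at this
      rw [norm_smul, Real.norm_natCast] at h1
      have h2 : θ + (n : ℝ) • u ∉ B := by
        rw [Metric.mem_ball, dist_zero_right, not_lt]
        nlinarith
      simp [h2]
  rw [lintegral_zero] at hlim
  exact absurd (ge_of_tendsto' hlim hle) (not_le.2 hc)

section Positivity

variable {V : Type*} [Fintype V] [DecidableEq V] {I : V → Type*} [∀ γ, Fintype (I γ)]
  [∀ γ, DecidableEq (I γ)] {G : SimpleGraph V} [DecidableRel G.Adj] {b : ∀ γ, I γ}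

@[fun_prop]
theorem continuous_logOdds (i : ∀ γ, I γ) :
    Continuous fun θ : Param G b → ℝ => logOdds θ i := by
  simp only [logOdds_eq]
  fun_prop

theorem logOdds_sub_smul (θ u : Param G b → ℝ) (t : ℝ) (i : ∀ γ, I γ) :
    logOdds (θ - t • u) i = logOdds θ i - t * logOdds u i := by
  simp only [logOdds_eq, Finset.mul_sum, ← Finset.sum_sub_distrib]
  refine Finset.sum_congr rfl fun q _ => ?_
  simp only [Pi.sub_apply, Pi.smul_apply, smul_eq_mul]
  ring

/-- The facet normal of the cell `z` of the `K`-marginal table. -/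
noncomputable def facetNormal (b : ∀ γ, I γ) (K : Finset V) (z : ∀ γ, I γ) (q : Param G b) : ℝ :=
  if q.1.1 ⊆ K then mobius b z (cell q) else 0

/-- The Möbius coefficients expand the indicator of `x_K = z` in the indicators above the cells on
`K`; the baseline coefficient is the constant term. Completeness of `K` makes all other coefficients
available as parameters. -/
theorem logOdds_facetNormal {K : Finset V} (hK : G.IsClique (K : Set V)) (z x : ∀ γ, I γ) :
    mobius b z b + logOdds (facetNormal (G := G) b K z) x = if z = restr b K x then 1 else 0 := by
  rw [← sum_mobius_mul_below, logOdds_eq]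
  have h1 : ∑ w, mobius b z w * (if Below b w (restr b K x) then (1 : ℝ) else 0) =
      ∑ w ∈ cellsOn b K, mobius b z w * above b w x := by
    rw [← Finset.sum_subset (Finset.subset_univ (cellsOn b K)) fun w _ hw => by
      rw [if_neg fun h => hw (h.mem_cellsOn (restr_mem K x)), mul_zero]]
    exact Finset.sum_congr rfl fun w hw => by rw [← above_restr hw, above]
  rw [h1, sum_cellsOn hK, above, if_pos (baseline_below x), mul_one, Finset.sum_filter]
  congr 1
  refine Finset.sum_congr rfl fun q _ => ?_
  unfold facetNormal
  split_ifs <;> ring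

theorem sum_facetNormal {K : Finset V} (hK : G.IsClique (K : Set V)) (z : ∀ γ, I γ)
    (s : Param G b → ℝ) (α : ℝ) :
    mobius b z b * α + ∑ q, facetNormal b K z q * s q =
      cellHyper b (withBaseline α s) K z := by
  rw [cellHyper, sum_cellsOn hK, withBaseline_baseline, Finset.sum_filter]
  congr 1
  refine Finset.sum_congr rfl fun q _ => ?_
  unfold facetNormal
  rw [withBaseline_cell]
  split_ifs <;> ring

/-- Replacing `θ` by `θ - n u`, with `u` the facet normal, multiplies the kernel by `exp(-n α^K(z))`
up to factors bounded in `n`. If `α^K(z) ≤ 0`, the kernel stays bounded below along `u`, against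
integrability. The second cell `z'` makes `u` nonzero and keeps the partition sum away from zero. -/
theorem cellHyper_pos_of_ne {s : Param G b → ℝ} {α : ℝ} (hproper : Integrable (priorKernel s α))
    {K : Finset V} (hK : G.IsClique (K : Set V)) {z z' : ∀ γ, I γ} (hz : z ∈ cellsOn b K)
    (hz' : z' ∈ cellsOn b K) (hne : z' ≠ z) : 0 < cellHyper b (withBaseline α s) K z := by
  by_contra hle
  rw [not_lt] at hle
  set u : Param G b → ℝ := facetNormal b K z with hu
  set c := mobius b z b with hc
  have hlog := logOdds_facetNormal (b := b) hK z
  have hu0 : u ≠ 0 := by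
    intro h0
    have h1 := hlog z
    have h2 := hlog z'
    rw [restr_eq_self hz, if_pos rfl, ← hu, h0] at h1
    rw [restr_eq_self hz', if_neg hne.symm, ← hu, h0] at h2
    have : ∀ x, logOdds (0 : Param G b → ℝ) x = 0 := fun x => by simp [logOdds]
    rw [this] at h1 h2
    linarith
  -- The cells not projecting to `z` keep their weight under the translation, so `Z0` and the full
  -- sum bound the translated sum `W` uniformly in `n`.
  let Z0 : (Param G b → ℝ) → ℝ := fun θ => ∑ x with z ≠ restr b K x, Real.exp (logOdds θ x)
  let g : (Param G b → ℝ) → ℝ := fun θ => Real.exp (∑ q, θ q * s q -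
    |α| * (|Real.log (Z0 θ)| + |Real.log (∑ x, Real.exp (logOdds θ x))|))
  have hgm : Measurable g := by
    refine Real.measurable_exp.comp (Measurable.sub (by fun_prop) (Measurable.const_mul ?_ _))
    refine Measurable.add ?_ ?_
    · exact (Real.measurable_log.comp
        (Continuous.measurable (by simp only [Z0]; fun_prop))).abs
    · exact (Real.measurable_log.comp (Continuous.measurable (by fun_prop))).abs
  refine not_forall_le_translate hproper hgm (fun θ => Real.exp_pos _) hu0 fun n θ => ?_
  let W : ℝ := ∑ x, Real.exp (logOdds θ x - n * if z = restr b K x then 1 else 0)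
  have hZ0 : 0 < Z0 θ := Finset.sum_pos (fun _ _ => Real.exp_pos _)
    ⟨z', by simpa [restr_eq_self hz'] using hne.symm⟩
  have hW0 : Z0 θ ≤ W := by
    simp only [Z0, W, Finset.sum_filter]
    refine Finset.sum_le_sum fun x _ => ?_
    by_cases hx : z = restr b K x
    · simp only [hx, ne_eq, not_true_eq_false, if_false]
      exact (Real.exp_pos _).le
    · simp [hx]
  have hW1 : W ≤ ∑ x, Real.exp (logOdds θ x) := by
    refine Finset.sum_le_sum fun x _ => Real.exp_le_exp.2 ?_
    have : 0 ≤ (n : ℝ) * if z = restr b K x then (1 : ℝ) else 0 := by positivity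
    linarith
  have hWpos : 0 < W := hZ0.trans_le hW0
  have hpart : partitionFn (θ - (n : ℝ) • u) = Real.exp (n * c) * W := by
    rw [partitionFn_eq, Finset.mul_sum]
    refine Finset.sum_congr rfl fun x _ => ?_
    rw [← Real.exp_add, logOdds_sub_smul, ← hlog x]
    congr 1
    ring
  have hlogW : |Real.log W| ≤
      |Real.log (Z0 θ)| + |Real.log (∑ x, Real.exp (logOdds θ x))| := by
    have h1 := Real.log_le_log hZ0 hW0
    have h2 := Real.log_le_log hWpos hW1
    rw [abs_le]
    constructor
    · have := neg_abs_le (Real.log (Z0 θ))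
      have := abs_nonneg (Real.log (∑ x, Real.exp (logOdds θ x)))
      linarith
    · have := le_abs_self (Real.log (∑ x, Real.exp (logOdds θ x)))
      have := abs_nonneg (Real.log (Z0 θ))
      linarith
  have hα : α * Real.log W ≤
      |α| * (|Real.log (Z0 θ)| + |Real.log (∑ x, Real.exp (logOdds θ x))|) :=
    (le_abs_self _).trans (by rw [abs_mul]; gcongr)
  have hsum : ∑ q, (θ - (n : ℝ) • u) q * s q =
      ∑ q, θ q * s q - n * ∑ q, u q * s q := by
    rw [Finset.mul_sum, ← Finset.sum_sub_distrib]
    refine Finset.sum_congr rfl fun q _ => ?_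
    simp only [Pi.sub_apply, Pi.smul_apply, smul_eq_mul]
    ring
  have hdual := sum_facetNormal hK z s α
  have hn : (n : ℝ) * cellHyper b (withBaseline α s) K z ≤ 0 :=
    mul_nonpos_of_nonneg_of_nonpos n.cast_nonneg hle
  rw [← hdual] at hn
  simp only [g, priorKernel]
  rw [hpart, Real.log_mul (Real.exp_ne_zero _) hWpos.ne', Real.log_exp, hsum]
  apply Real.exp_le_exp.2
  linarith

/-- `α` is the total of the hyperparameters of any marginal table; one over a single vertex with at
least two levels has only positive entries. -/
theorem baselineHyper_pos [Nontrivial (∀ γ, I γ)] {s : Param G b → ℝ} {α : ℝ}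
    (hproper : Integrable (priorKernel s α)) : 0 < α := by
  obtain ⟨x, hx⟩ := exists_ne b
  obtain ⟨γ, hγ⟩ := Function.ne_iff.1 hx
  have hK : G.IsClique (({γ} : Finset V) : Set V) := by simp
  have hmem := restr_mem (b := b) {γ} x
  have hne : restr b {γ} x ≠ b := by
    intro h
    apply hγ
    rw [← restr_apply_mem (b := b) (Finset.mem_singleton_self γ) x, h]
  have hsum := sum_cellHyper (b := b) (withBaseline α s) {γ}
  rw [withBaseline_baseline] at hsum
  rw [← hsum]
  refine Finset.sum_pos (fun w hw => ?_) ⟨b, baseline_mem _⟩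
  by_cases h : w = b
  · exact cellHyper_pos_of_ne hproper hK hw hmem (h ▸ hne)
  · exact cellHyper_pos_of_ne hproper hK hw (baseline_mem _) (Ne.symm h)

theorem cellHyper_pos [Nontrivial (∀ γ, I γ)] {s : Param G b → ℝ} {α : ℝ}
    (hproper : Integrable (priorKernel s α)) {K : Finset V} (hK : G.IsClique (K : Set V))
    {z : ∀ γ, I γ} (hz : z ∈ cellsOn b K) : 0 < cellHyper b (withBaseline α s) K z := by
  by_cases h : ∃ z' ∈ cellsOn b K, z' ≠ z
  · obtain ⟨z', hz', hne⟩ := h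
    exact cellHyper_pos_of_ne hproper hK hz hz' hne
  -- A marginal table with one cell, such as that of an empty separator, has `α` as its only
  -- hyperparameter.
  · push Not at h
    have hsum := sum_cellHyper (b := b) (withBaseline α s) K
    rw [withBaseline_baseline, Finset.sum_eq_single_of_mem z hz fun w hw hne =>
      absurd (h w hw) hne] at hsum
    rw [hsum]
    exact baselineHyper_pos hproper

end Positivity

/-! ### The coordinates `p^G`: injectivity, derivative, and the link with the Poisson integral. -/

section Coordinates

variable {V : Type*} [Fintype V] [DecidableEq V] {I : V → Type*} [∀ γ, Fintype (I γ)]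
  [∀ γ, DecidableEq (I γ)] {G : SimpleGraph V} [DecidableRel G.Adj] {b : ∀ γ, I γ}

/-- The matrix expressing the free marginals in terms of the mean parameters. -/
noncomputable def coordMatrix (b : ∀ γ, I γ) (A : CompleteSet G → Finset V) :
    Matrix (Param G b) (Param G b) ℝ :=
  Matrix.of fun q r => facetNormal b (A q.1) (cell q) r

theorem det_coordMatrix {A : CompleteSet G → Finset V} (hA : ∀ D : CompleteSet G, D.1 ⊆ A D) :
    (coordMatrix b A).det = 1 := by
  refine det_eq_one_of_graded _ (fun q => (support b (cell q)).card) (fun q => ?_)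
    fun q r h hne => ?_
  · rw [coordMatrix, Matrix.of_apply, facetNormal, if_pos (hA q.1), mobius_self]
  · have hb : Below b (cell q) (cell r) := by
      by_contra h'
      exact h (by rw [coordMatrix, Matrix.of_apply, facetNormal, mobius_of_not_below h', ite_self])
    by_contra hc
    exact hne (cell_injective (hb.eq_of_card_le (not_lt.1 hc)))

/-- The constant term of the expansion vanishes because the cell of `q` is not the baseline; hence
`p^G` is linear in the mean parameters. -/
theorem sum_coordMatrix_mul_above {A : CompleteSet G → Finset V}
    (hA : ∀ D : CompleteSet G, D.1 ⊆ A D ∧ G.IsClique (A D : Set V)) (q : Param G b)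
    (x : ∀ γ, I γ) : ∑ r, coordMatrix b A q r * above b (cell r) x =
      if ∀ γ ∈ A q.1, x γ = extend b q.2 γ then 1 else 0 := by
  have h := logOdds_facetNormal (b := b) (hA q.1).2 (cell q) x
  rw [mobius_of_not_below fun h => cell_ne q (below_baseline_iff.1 h), zero_add, logOdds_eq] at h
  have hiff : (∀ γ ∈ A q.1, x γ = extend b q.2 γ) ↔ cell q = restr b (A q.1) x := by
    rw [eq_comm, restr_eq_iff (cell_mem_cellsOn.2 (hA q.1).1)]
    rfl
  simp only [hiff]
  rw [← h]
  exact Finset.sum_congr rfl fun r _ => mul_comm _ _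

/-- The mean parameters of a table. -/
noncomputable def meanParam (p : (∀ γ, I γ) → ℝ) (q : Param G b) : ℝ :=
  ∑ x, p x * above b (cell q) x

theorem sum_filter_eq {A : CompleteSet G → Finset V}
    (hA : ∀ D : CompleteSet G, D.1 ⊆ A D ∧ G.IsClique (A D : Set V)) (q : Param G b)
    (f : (∀ γ, I γ) → ℝ) : ∑ x with ∀ γ ∈ A q.1, x γ = extend b q.2 γ, f x =
      ∑ r, coordMatrix b A q r * ∑ x, f x * above b (cell r) x := by
  rw [Finset.sum_filter]
  simp only [Finset.mul_sum]
  rw [Finset.sum_comm]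
  refine Finset.sum_congr rfl fun x _ => ?_
  have h := sum_coordMatrix_mul_above hA q x
  have h' : (if ∀ γ ∈ A q.1, x γ = extend b q.2 γ then f x else 0) =
      f x * if ∀ γ ∈ A q.1, x γ = extend b q.2 γ then 1 else 0 := by
    split_ifs <;> simp
  rw [h', ← h, Finset.mul_sum]
  exact Finset.sum_congr rfl fun r _ => by ring

theorem freeMarginals_eq_mulVec {A : CompleteSet G → Finset V}
    (hA : ∀ D : CompleteSet G, D.1 ⊆ A D ∧ G.IsClique (A D : Set V)) (p : (∀ γ, I γ) → ℝ) :
    freeMarginals (b := b) A p = (coordMatrix b A).mulVec (meanParam p) := by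
  funext q
  exact sum_filter_eq hA q p

theorem sub_mul_log_sub_log_nonneg {x y : ℝ} (hx : 0 < x) (hy : 0 < y) :
    0 ≤ (x - y) * (Real.log x - Real.log y) := by
  rcases le_total x y with h | h
  · exact mul_nonneg_of_nonpos_of_nonpos (by linarith)
      (by linarith [Real.log_le_log hx h])
  · exact mul_nonneg (by linarith) (by linarith [Real.log_le_log hy h])

/-- Equal `p^G` means equal mean parameters. The symmetrized Kullback-Leibler divergence of two
tables of the model is the pairing of the differences of their log-linear and mean parameters, so it
vanishes; its terms are nonnegative and vanish only where the tables agree. -/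
theorem injOn_freeMarginals {A : CompleteSet G → Finset V}
    (hA : ∀ D : CompleteSet G, D.1 ⊆ A D ∧ G.IsClique (A D : Set V)) :
    Set.InjOn (freeMarginals (b := b) A) (model G b) := by
  rw [model_eq_range]
  rintro _ ⟨θ, rfl⟩ _ ⟨θ', rfl⟩ h
  rw [freeMarginals_eq_mulVec hA, freeMarginals_eq_mulVec hA] at h
  have hU : IsUnit (coordMatrix b A) := by
    rw [Matrix.isUnit_iff_isUnit_det, det_coordMatrix fun D => (hA D).1]
    exact isUnit_one
  have hm := Matrix.mulVec_injective_of_isUnit hU h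
  have hsum : ∑ x, (cellProb θ x - cellProb θ' x) *
      (Real.log (cellProb θ x) - Real.log (cellProb θ' x)) = 0 := by
    have h1 : ∀ x, (cellProb θ x - cellProb θ' x) *
        (Real.log (cellProb θ x) - Real.log (cellProb θ' x)) =
        (cellProb θ x - cellProb θ' x) *
          (Real.log (partitionFn θ') - Real.log (partitionFn θ)) +
        ∑ q, (θ q - θ' q) * ((cellProb θ x - cellProb θ' x) * above b (cell q) x) := by
      intro x
      rw [log_cellProb, log_cellProb, logOdds_eq, logOdds_eq]
      have : ∑ q, (θ q - θ' q) * ((cellProb θ x - cellProb θ' x) * above b (cell q) x) =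
          (cellProb θ x - cellProb θ' x) *
            (∑ q, above b (cell q) x * θ q - ∑ q, above b (cell q) x * θ' q) := by
        rw [← Finset.sum_sub_distrib, Finset.mul_sum]
        exact Finset.sum_congr rfl fun q _ => by ring
      rw [this]
      ring
    simp only [h1]
    rw [Finset.sum_add_distrib, ← Finset.sum_mul, Finset.sum_sub_distrib, sum_cellProb,
      sum_cellProb, sub_self, zero_mul, zero_add, Finset.sum_comm]
    refine Finset.sum_eq_zero fun q _ => ?_
    rw [← Finset.mul_sum]
    have := congrFun hm q
    simp only [meanParam] at this
    rw [Finset.sum_congr rfl fun x _ => sub_mul _ _ _, Finset.sum_sub_distrib, this, sub_self,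
      mul_zero]
  funext x
  have hx := (Finset.sum_eq_zero_iff_of_nonneg fun x _ =>
    sub_mul_log_sub_log_nonneg (cellProb_pos θ x) (cellProb_pos θ' x)).1 hsum x (Finset.mem_univ x)
  rcases mul_eq_zero.1 hx with h | h
  · linarith
  · exact Real.log_injOn_pos (cellProb_pos θ x) (cellProb_pos θ' x) (by linarith)

/-- The covariance matrix of the indicators `above`. -/
noncomputable def covMatrix (b : ∀ γ, I γ) (p : (∀ γ, I γ) → ℝ) :
    Matrix (Param G b) (Param G b) ℝ :=
  Matrix.of fun q r => moment b p (cell q) (cell r) - meanParam p q * meanParam p r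

/-- The baseline and the parameter indices enumerate the complete cells. -/
noncomputable def sumParamEquiv (G : SimpleGraph V) [DecidableRel G.Adj] (b : ∀ γ, I γ) :
    Unit ⊕ Param G b ≃ completeCells G b :=
  Equiv.ofBijective (Sum.elim (fun _ => ⟨b, baseline_mem_completeCells⟩)
    fun q => ⟨cell q, cell_mem_completeCells q⟩) <| by
    constructor
    · rintro (i | q) (j | r) h
      · rfl
      · exact absurd (congrArg Subtype.val h).symm (cell_ne r)
      · exact absurd (congrArg Subtype.val h) (cell_ne q)
      · exact congrArg Sum.inr (cell_injective (congrArg Subtype.val h))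
    · rintro ⟨x, hx⟩
      by_cases h : x = b
      · exact ⟨Sum.inl (), Subtype.ext h.symm⟩
      · obtain ⟨q, hq⟩ := exists_cell hx h
        exact ⟨Sum.inr q, Subtype.ext hq⟩

/-- The indicator above the baseline is the constant one. The covariance matrix is the Schur
complement of its entry, which is the total mass. -/
theorem det_covMatrix {p : (∀ γ, I γ) → ℝ} (hp : ∑ x, p x = 1) :
    (covMatrix (G := G) b p).det = (momentMatrix b p (completeCells G b)).det := by
  have habove : ∀ x, above b b x = 1 := fun x => if_pos (baseline_below x)
  have h1 : (momentMatrix b p (completeCells G b)).submatrix (sumParamEquiv G b)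
      (sumParamEquiv G b) = Matrix.fromBlocks 1
        (Matrix.of fun (_ : Unit) r => meanParam p r) (Matrix.of fun q (_ : Unit) => meanParam p q)
        (Matrix.of fun q r => moment b p (cell q) (cell r)) := by
    ext i j
    rcases i with i | q <;> rcases j with j | r
    · change moment b p b b = _
      simp [moment, habove, hp]
    · change moment b p b (cell r) = meanParam p r
      simp [moment, habove, meanParam]
    · change moment b p (cell q) b = meanParam p q
      simp [moment, habove, meanParam]
    · rfl
  rw [← Matrix.det_submatrix_equiv_self (sumParamEquiv G b), h1, Matrix.det_fromBlocks_one₁₁]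
  congr 1
  ext q r
  simp [covMatrix, Matrix.mul_apply]

theorem hasFDerivAt_logOdds (θ : Param G b → ℝ) (x : ∀ γ, I γ) :
    HasFDerivAt (fun θ : Param G b → ℝ => logOdds θ x)
      (∑ r : Param G b, above b (cell r) x • ContinuousLinearMap.proj (R := ℝ) (φ := fun _ : Param G b => ℝ) r) θ := by
  have : (fun θ : Param G b → ℝ => logOdds θ x) =
      ⇑(∑ r : Param G b, above b (cell r) x •
        ContinuousLinearMap.proj (R := ℝ) (φ := fun _ : Param G b => ℝ) r) := by
    funext θ
    simp [logOdds_eq]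
  rw [this]
  exact ContinuousLinearMap.hasFDerivAt _

/-- The score of an exponential family: the gradient of `log p(x)` is the sufficient statistic minus
its mean. -/
theorem hasFDerivAt_cellProb (θ : Param G b → ℝ) (x : ∀ γ, I γ) :
    HasFDerivAt (fun θ : Param G b → ℝ => cellProb θ x)
      (∑ r : Param G b, (cellProb θ x * (above b (cell r) x - meanParam (cellProb θ) r)) •
        ContinuousLinearMap.proj (R := ℝ) (φ := fun _ : Param G b => ℝ) r) θ := by
  have hZ : HasFDerivAt (fun θ : Param G b → ℝ => partitionFn θ)
      (∑ y, Real.exp (logOdds θ y) •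
        ∑ r : Param G b, above b (cell r) y • ContinuousLinearMap.proj (R := ℝ) (φ := fun _ : Param G b => ℝ) r) θ := by
    simp only [partitionFn_eq]
    exact HasFDerivAt.fun_sum fun y _ => (hasFDerivAt_logOdds θ y).exp
  have hne := (partitionFn_pos θ).ne'
  have h := ((hasFDerivAt_logOdds θ x).sub (hZ.log hne)).exp
  have hfun : (fun θ : Param G b → ℝ => cellProb θ x) =
      fun θ => Real.exp (logOdds θ x - Real.log (partitionFn θ)) := by
    funext θ
    rw [Real.exp_sub, Real.exp_log (partitionFn_pos θ), cellProb]
  rw [hfun]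
  refine h.congr_fderiv ?_
  ext v
  have hx : Real.exp (logOdds θ x - Real.log (partitionFn θ)) = cellProb θ x :=
    (congrFun hfun θ).symm
  simp only [smul_apply, sub_apply,
    sum_apply, ContinuousLinearMap.proj_apply, smul_eq_mul, Pi.sub_apply]
  change Real.exp (logOdds θ x - Real.log (partitionFn θ)) * _ = _
  rw [hx]
  have hmean : (partitionFn θ)⁻¹ * ∑ y, Real.exp (logOdds θ y) * ∑ r, above b (cell r) y * v r =
      ∑ r, meanParam (cellProb θ) r * v r := by
    simp only [meanParam, Finset.mul_sum, Finset.sum_mul]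
    rw [Finset.sum_comm]
    refine Finset.sum_congr rfl fun r _ => Finset.sum_congr rfl fun y _ => ?_
    rw [cellProb]
    ring
  rw [hmean, ← Finset.sum_sub_distrib, Finset.mul_sum]
  exact Finset.sum_congr rfl fun r _ => by ring

theorem hasFDerivAt_freeMarginals {A : CompleteSet G → Finset V}
    (hA : ∀ D : CompleteSet G, D.1 ⊆ A D ∧ G.IsClique (A D : Set V)) (θ : Param G b → ℝ) :
    HasFDerivAt (fun θ : Param G b → ℝ => freeMarginals (b := b) A (cellProb θ))
      (LinearMap.toContinuousLinearMap
        (Matrix.toLin' (coordMatrix b A * covMatrix b (cellProb θ)))) θ := by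
  rw [hasFDerivAt_pi']
  intro q
  refine HasFDerivAt.congr_fderiv
    (HasFDerivAt.fun_sum fun x _ => hasFDerivAt_cellProb θ x) ?_
  ext v
  have h : ∀ r, ∑ x with ∀ γ ∈ A q.1, x γ = extend b q.2 γ,
      cellProb θ x * (above b (cell r) x - meanParam (cellProb θ) r) =
        (coordMatrix b A * covMatrix b (cellProb θ) : Matrix (Param G b) (Param G b) ℝ) q r := by
    intro r
    rw [sum_filter_eq hA, Matrix.mul_apply]
    refine Finset.sum_congr rfl fun r' _ => ?_
    congr 1
    simp only [covMatrix, Matrix.of_apply, moment]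
    rw [show meanParam (cellProb θ) r' = ∑ x, cellProb θ x * above b (cell r') x from rfl,
      Finset.sum_mul, ← Finset.sum_sub_distrib]
    exact Finset.sum_congr rfl fun x _ => by ring
  simp only [sum_apply, smul_apply,
    ContinuousLinearMap.proj_apply, smul_eq_mul, ContinuousLinearMap.comp_apply,
    LinearMap.coe_toContinuousLinearMap', Matrix.toLin'_apply, Matrix.mulVec, dotProduct, ← h,
    Finset.sum_mul]
  rw [Finset.sum_comm]

theorem continuous_partitionFn : Continuous fun θ : Param G b → ℝ => partitionFn θ := by
  rw [funext partitionFn_eq]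
  fun_prop

/-- The Poisson total mean is `exp t * Z`, with `t` the baseline parameter. Translating `t` by `log
Z` splits off a Gamma integral with exponent `α` and leaves the factor `Z ^ (-α)` of the prior. -/
theorem lintegral_priorKernel {α : ℝ} (hα : 0 < α) (s : Param G b → ℝ) :
    poissonConst b (withBaseline α s) (completeCells G b) Finset.univ =
      ENNReal.ofReal (Real.Gamma α) * ∫⁻ θ : Param G b → ℝ, ENNReal.ofReal (priorKernel s α θ) := by
  have hcont : Continuous fun θ : Param G b → ℝ => priorKernel s α θ := by
    unfold priorKernel
    refine Real.continuous_exp.comp (Continuous.sub (by fun_prop) (continuous_const.mul ?_))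
    exact continuous_partitionFn.log fun θ => (partitionFn_pos θ).ne'
  have key : ∀ θ : (∀ γ, I γ) → ℝ, ∫⁻ t : ℝ, poissonWeight b (withBaseline α s)
      (completeCells G b) Finset.univ (Function.update θ b t) =
      ENNReal.ofReal (Real.Gamma α) * ENNReal.ofReal (priorKernel s α fun q => θ (cell q)) := by
    intro θ
    set θ' : Param G b → ℝ := fun q => θ (cell q)
    set Z := partitionFn θ'
    have hZ : 0 < Z := partitionFn_pos θ'
    have h1 : ∀ t : ℝ, poissonWeight b (withBaseline α s) (completeCells G b) Finset.univ
        (Function.update θ b t) =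
        ENNReal.ofReal (Real.exp (α * (t + Real.log Z) - Real.exp (t + Real.log Z))) *
          ENNReal.ofReal (priorKernel s α θ') := by
      intro t
      rw [poissonWeight_congr (θ' := withBaseline t θ') _ _ fun y hy => ?_]
      · rw [poissonWeight, sum_completeCells, cellsOn_univ]
        simp only [expSum_completeCells, withBaseline_baseline, withBaseline_cell, Real.exp_add]
        rw [← Finset.mul_sum, ← partitionFn_eq, Real.exp_log hZ,
          ← ENNReal.ofReal_mul (Real.exp_nonneg _), priorKernel, ← Real.exp_add]
        congr 2
        ring
      · by_cases h : y = b
        · subst h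
          simp
        · obtain ⟨q, rfl⟩ := exists_cell hy h
          rw [Function.update_of_ne h, withBaseline_cell]
    simp only [h1]
    rw [lintegral_mul_const _ (by fun_prop), lintegral_add_right_eq_self
      (fun t : ℝ => ENNReal.ofReal (Real.exp (α * t - Real.exp t))), lintegral_exp_gamma hα]
  rw [poissonConst, completeCells_eq, lmarginal_insert' _ (measurable_poissonWeight _ _ _)
    (baseline_notMem_image _), ← completeCells_eq, funext key]
  have h := lmarginal_image (μ := fun _ : (∀ γ, I γ) => (volume : Measure ℝ)) cell_injective
    (Finset.univ : Finset (Param G b))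
    (f := fun θ => ENNReal.ofReal (Real.Gamma α) * ENNReal.ofReal (priorKernel s α θ))
    (by fun_prop) 0
  rw [lmarginal_univ] at h
  rw [← lintegral_const_mul _ (by fun_prop)]
  exact h

end Coordinates

/-! ### The normalizing constant and the law of `p^G`. -/

section Main

variable {V : Type*} [Fintype V] [DecidableEq V] {I : V → Type*} [∀ γ, Fintype (I γ)]
  [∀ γ, DecidableEq (I γ)] {G : SimpleGraph V} [DecidableRel G.Adj] {b : ∀ γ, I γ}
  {m : ℕ} {C : Fin (m + 1) → Finset V}

theorem IsPerfectOrdering.freeChoice_isClique (hC : IsPerfectOrdering G C)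
    {A : CompleteSet G → Finset V} (hA : IsFreeChoice G C A) (D : CompleteSet G) :
    D.1 ⊆ A D ∧ G.IsClique (A D : Set V) := by
  refine ⟨(hA D).1, ?_⟩
  rcases (hA D).2 with ⟨l, hl⟩ | ⟨-, l, hl⟩
  · rw [hl]; exact hC.isClique_sep l
  · rw [hl]; exact hC.isClique l

theorem det_momentMatrix_pos (hC : IsPerfectOrdering G C) (θ : Param G b → ℝ) :
    0 < (momentMatrix b (cellProb θ) (completeCells G b)).det := by
  have hdet := hC.det_momentMatrix_mul (cellProb_eq_expSum θ)
  have hR : ∀ K : Finset V, 0 < ∏ z ∈ cellsOn b K, marginal (cellProb θ) K z := fun K =>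
    Finset.prod_pos fun z _ => marginal_pos (cellProb_pos θ) K z
  have h := Finset.prod_pos (s := Finset.univ) fun (l : Fin (m + 1)) _ => hR (C l)
  rw [← hdet] at h
  exact pos_of_mul_pos_left h (Finset.prod_pos fun l _ => hR (sep C l)).le

variable [Nontrivial (∀ γ, I γ)] {s : Param G b → ℝ} {α : ℝ}

theorem gammaProd_pos (hproper : Integrable (priorKernel s α)) {K : Finset V}
    (hK : G.IsClique (K : Set V)) : 0 < gammaProd K (alphaEmpty s α K) (alphaCell s K) := by
  rw [gammaProd_eq s α hK]
  exact Finset.prod_pos fun z hz => Real.Gamma_pos_of_pos (cellHyper_pos hproper hK hz)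

theorem poissonConst_clique (hproper : Integrable (priorKernel s α)) {K : Finset V}
    (hK : G.IsClique (K : Set V)) : poissonConst b (withBaseline α s) (cellsOn b K) K =
      ENNReal.ofReal (gammaProd K (alphaEmpty s α K) (alphaCell s K)) := by
  rw [gammaProd_eq s α hK, poissonConst_cellsOn _ fun z hz => cellHyper_pos hproper hK hz]

theorem normConst_eq (hC : IsPerfectOrdering G C) (hproper : Integrable (priorKernel s α)) :
    normConst s α =
      (∏ l, gammaProd (C l) (alphaEmpty s α (C l)) (alphaCell s (C l))) /
        (Real.Gamma α *
          ∏ l, gammaProd (sep C l) (alphaEmpty s α (sep C l)) (alphaCell s (sep C l))) := by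
  have hα := baselineHyper_pos hproper
  have hΓ := Real.Gamma_pos_of_pos hα
  have hc := fun l => gammaProd_pos hproper (hC.isClique l)
  have hs := fun l => gammaProd_pos hproper (hC.isClique_sep l)
  have hI : 0 ≤ normConst s α := integral_nonneg fun _ => (Real.exp_pos _).le
  -- The identity holds in `ENNReal`; properness and positivity of the Gamma products allow it to be
  -- read in the reals.
  have h := hC.poissonConst_mul (b := b) (withBaseline α s)
  rw [Finset.prod_congr rfl fun l _ => poissonConst_clique hproper (hC.isClique l),
    Finset.prod_congr rfl fun l _ => poissonConst_clique hproper (hC.isClique_sep l),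
    lintegral_priorKernel hα, ← ofReal_integral_eq_lintegral_ofReal hproper
      (Filter.Eventually.of_forall fun _ => (Real.exp_pos _).le),
    ← ENNReal.ofReal_prod_of_nonneg fun l _ => (hc l).le,
    ← ENNReal.ofReal_prod_of_nonneg fun l _ => (hs l).le,
    ← normConst, ← ENNReal.ofReal_mul hΓ.le, ← ENNReal.ofReal_mul (mul_nonneg hΓ.le hI),
    ENNReal.ofReal_eq_ofReal_iff
      (mul_nonneg (mul_nonneg hΓ.le hI) (Finset.prod_nonneg fun l _ => (hs l).le))
      (Finset.prod_nonneg fun l _ => (hc l).le)] at h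
  rw [eq_div_iff (mul_pos hΓ (Finset.prod_pos fun l _ => hs l)).ne', ← h]
  ring

/-- The exponent of the kernel is the pairing of the transform of `log p` with `(s, α)`, with `-log
Z` at the baseline; the factorization of `p` turns it into clique and separator terms. -/
theorem priorKernel_mul_prod (hC : IsPerfectOrdering G C) (s : Param G b → ℝ) (α : ℝ)
    (θ : Param G b → ℝ) :
    priorKernel s α θ * ∏ l, ∏ z ∈ cellsOn b (sep C l),
        marginal (cellProb θ) (sep C l) z ^ cellHyper b (withBaseline α s) (sep C l) z =
      ∏ l, ∏ z ∈ cellsOn b (C l),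
        marginal (cellProb θ) (C l) z ^ cellHyper b (withBaseline α s) (C l) z := by
  have hpow : ∀ K : Finset V, ∏ z ∈ cellsOn b K,
      marginal (cellProb θ) K z ^ cellHyper b (withBaseline α s) K z =
        Real.exp (∑ z ∈ cellsOn b K,
          cellHyper b (withBaseline α s) K z * Real.log (marginal (cellProb θ) K z)) := by
    intro K
    rw [Real.exp_sum]
    refine Finset.prod_congr rfl fun z _ => ?_
    rw [Real.rpow_def_of_pos (marginal_pos (cellProb_pos θ) K z), mul_comm]
  have h := hC.sum_mobiusTransform_log (cellProb_eq_expSum θ) (withBaseline α s)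
  rw [sum_completeCells] at h
  simp only [mobiusTransform_log_cellProb, baseline_mem_completeCells, cell_mem_completeCells,
    if_true, withBaseline_baseline, withBaseline_cell] at h
  simp only [hpow, ← Real.exp_sum]
  rw [priorKernel, ← Real.exp_add]
  congr 1
  linarith

/-- The change of variables between the prior density and the hyper Dirichlet density. -/
theorem det_mul_hyperDirichletDensity (hC : IsPerfectOrdering G C)
    (hproper : Integrable (priorKernel s α)) (θ : Param G b → ℝ) :
    (momentMatrix b (cellProb θ) (completeCells G b)).det *
        hyperDirichletDensity C (alphaEmpty s α) (alphaCell s) (cellProb θ) =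
      (normConst s α)⁻¹ * priorKernel s α θ := by
  have hΓ := (Real.Gamma_pos_of_pos (baselineHyper_pos hproper)).ne'
  have hdens : ∀ K : Finset V, G.IsClique (K : Set V) →
      dirichletDensity K (alphaEmpty s α K) (alphaCell s K) (cellProb θ) =
        Real.Gamma α * (gammaProd K (alphaEmpty s α K) (alphaCell s K))⁻¹ *
          ((∏ z ∈ cellsOn b K,
            marginal (cellProb θ) K z ^ cellHyper b (withBaseline α s) K z) *
              (∏ z ∈ cellsOn b K, marginal (cellProb θ) K z)⁻¹) := by
    intro K hK
    rw [dirichletDensity_eq s α hK, gammaProd_eq s α hK, div_eq_mul_inv, ← div_eq_mul_inv _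
      (∏ z ∈ cellsOn b K, marginal (cellProb θ) K z), ← Finset.prod_div_distrib]
    congr 1
    exact Finset.prod_congr rfl fun z _ =>
      Real.rpow_sub_one (marginal_pos (cellProb_pos θ) K z).ne' _
  have hg := fun (K : Finset V) (hK : G.IsClique (K : Set V)) =>
    (gammaProd_pos hproper hK).ne'
  have hE : ∀ K : Finset V, ∏ z ∈ cellsOn b K,
      marginal (cellProb θ) K z ^ cellHyper b (withBaseline α s) K z ≠ 0 := fun K =>
    (Finset.prod_pos fun z _ =>
      Real.rpow_pos_of_pos (marginal_pos (cellProb_pos θ) K z) _).ne'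
  have hR : ∀ K : Finset V, ∏ z ∈ cellsOn b K, marginal (cellProb θ) K z ≠ 0 := fun K =>
    (Finset.prod_pos fun z _ => marginal_pos (cellProb_pos θ) K z).ne'
  have hdet := hC.det_momentMatrix_mul (cellProb_eq_expSum θ)
  have hker := priorKernel_mul_prod hC s α θ
  rw [hyperDirichletDensity, Finset.prod_congr rfl fun l _ => hdens (C l) (hC.isClique l),
    Finset.prod_congr rfl fun l _ => hdens (sep C l) (hC.isClique_sep l), normConst_eq hC hproper]
  -- There is one more clique than separators, so a single `Γ(α)` survives; it matches the one in
  -- the normalizing constant.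
  simp only [Finset.prod_mul_distrib, Finset.prod_const, Finset.prod_inv_distrib, Finset.card_univ,
    Fintype.card_fin]
  rw [← hdet, ← hker]
  have h1 : ∏ l, gammaProd (C l) (alphaEmpty s α (C l)) (alphaCell s (C l)) ≠ 0 :=
    Finset.prod_ne_zero_iff.2 fun l _ => hg _ (hC.isClique l)
  have h2 : ∏ l, gammaProd (sep C l) (alphaEmpty s α (sep C l)) (alphaCell s (sep C l)) ≠ 0 :=
    Finset.prod_ne_zero_iff.2 fun l _ => hg _ (hC.isClique_sep l)
  have h3 : ∏ l, ∏ z ∈ cellsOn b (sep C l), marginal (cellProb θ) (sep C l) z ^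
      cellHyper b (withBaseline α s) (sep C l) z ≠ 0 :=
    Finset.prod_ne_zero_iff.2 fun l _ => hE _
  have h4 : ∏ l, ∏ z ∈ cellsOn b (sep C l), marginal (cellProb θ) (sep C l) z ≠ 0 :=
    Finset.prod_ne_zero_iff.2 fun l _ => hR _
  have h5 := (det_momentMatrix_pos (b := b) hC θ).ne'
  field_simp
  ring

/-- The change of variables formula for an injective differentiable map. Its range is the set of
values of `p^G` on the model, and there the table can be recovered by `invFunOn`. -/
theorem map_prior (hC : IsPerfectOrdering G C) {A : CompleteSet G → Finset V}
    (hA : IsFreeChoice G C A) (hproper : Integrable (priorKernel s α)) :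
    (prior s α).map (fun θ => freeMarginals A (cellProb θ)) =
      hyperDirichletLaw C A (alphaEmpty s α) (alphaCell s) := by
  have hA' := hC.freeChoice_isClique hA
  set f : (Param G b → ℝ) → Param G b → ℝ := fun θ => freeMarginals A (cellProb θ) with hf
  have hd := hasFDerivAt_freeMarginals (b := b) hA'
  have hinjOn := injOn_freeMarginals (b := b) hA'
  have hinj : Function.Injective f := fun θ θ' h =>
    cellProb_injective (hinjOn (cellProb_mem_model θ) (cellProb_mem_model θ') h)
  have hmeas : Measurable f :=
    (continuous_iff_continuousAt.2 fun θ => (hd θ).continuousAt).measurable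
  have himage : freeMarginals (b := b) A '' model G b = f '' Set.univ := by
    rw [model_eq_range, Set.image_univ, ← Set.range_comp]
    rfl
  have hrange : MeasurableSet (f '' Set.univ) :=
    measurable_image_of_fderivWithin MeasurableSet.univ (fun θ _ => (hd θ).hasFDerivWithinAt)
      hinj.injOn
  have hinv : ∀ θ, Function.invFunOn (freeMarginals (b := b) A) (model G b) (f θ) = cellProb θ :=
    fun θ => hinjOn.leftInvOn_invFunOn (cellProb_mem_model θ)
  set d : (Param G b → ℝ) → ENNReal := fun x =>
    ENNReal.ofReal (hyperDirichletDensity C (alphaEmpty s α) (alphaCell s)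
      (Function.invFunOn (freeMarginals (b := b) A) (model G b) x)) with hdd
  ext B hB
  rw [Measure.map_apply hmeas hB, prior, withDensity_apply _ (hmeas hB), hyperDirichletLaw,
    withDensity_apply _ hB, himage, setLIntegral_indicator hrange]
  have hset : f '' Set.univ ∩ B = f '' (f ⁻¹' B) := by
    rw [Set.image_preimage_eq_inter_range, Set.image_univ, Set.inter_comm]
  rw [hset, lintegral_image_eq_lintegral_abs_det_fderiv_mul volume (hmeas hB)
    (fun θ _ => (hd θ).hasFDerivWithinAt) hinj.injOn]
  refine lintegral_congr fun θ => ?_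
  -- The coordinate matrix is unimodular, so only the covariance determinant remains.
  have hdet : (LinearMap.toContinuousLinearMap
      (Matrix.toLin' (coordMatrix b A * covMatrix b (cellProb θ)))).det =
      (momentMatrix b (cellProb θ) (completeCells G b)).det := by
    rw [LinearMap.det_toContinuousLinearMap, LinearMap.det_toLin', Matrix.det_mul,
      det_coordMatrix fun D => (hA' D).1, one_mul, det_covMatrix (sum_cellProb θ)]
  rw [hdet, abs_of_pos (det_momentMatrix_pos hC θ), hinv,
    ← ENNReal.ofReal_mul (det_momentMatrix_pos hC θ).le, det_mul_hyperDirichletDensity hC hproper]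

end Main

end HyperDirichlet

open HyperDirichlet in
theorem proposition4p1 {V : Type*} [Fintype V] [DecidableEq V]
    {I : V → Type*} [∀ γ, Fintype (I γ)] [∀ γ, DecidableEq (I γ)]
    -- the table has at least two cells
    [Nontrivial (∀ γ, I γ)]
    (G : SimpleGraph V) [DecidableRel G.Adj]
    -- the baseline cell
    (b : ∀ γ, I γ)
    -- `G` is decomposable, with cliques `C 0, …, C m` and separators `sep C l`, `l < m`
    {m : ℕ} (C : Fin (m + 1) → Finset V) (hC : IsPerfectOrdering G C)
    -- the choice of the coordinates `p^G`
    (A : CompleteSet G → Finset V) (hA : IsFreeChoice G C A)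
    -- the hyperparameters, for which the prior is proper
    (s : Param G b → ℝ) (α : ℝ) (hproper : Integrable (priorKernel s α)) :
    -- on the model, `p^G` determines the table
    Set.InjOn (freeMarginals (b := b) A) (model G b) ∧
    -- the hyperparameters given by `(s, α)` are positive and hyperconsistent
    (∀ K, (K ∈ Set.range C ∨ K ∈ Set.range (sep C)) →
      0 < alphaEmpty s α K ∧ ∀ d : Param G b, d.1.1 ⊆ K → 0 < alphaCell s K d) ∧
    HyperConsistent C (alphaEmpty s α) (alphaCell s) ∧
    -- the law of `p^G` induced by the prior is the hyper Dirichlet law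
    (prior s α).map (fun θ => freeMarginals A (cellProb θ)) =
      hyperDirichletLaw C A (alphaEmpty s α) (alphaCell s) ∧
    -- the normalizing constant
    normConst s α =
      (∏ l, gammaProd (C l) (alphaEmpty s α (C l)) (alphaCell s (C l))) /
        (Real.Gamma α *
          ∏ l, gammaProd (sep C l) (alphaEmpty s α (sep C l)) (alphaCell s (sep C l))) := by
  refine ⟨injOn_freeMarginals (hC.freeChoice_isClique hA), fun K hK => ?_,
    hyperConsistent hC.isClique s α, map_prior hC hA hproper, normConst_eq hC hproper⟩
  have hcl : G.IsClique (K : Set V) := by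
    rcases hK with ⟨l, rfl⟩ | ⟨l, rfl⟩
    · exact hC.isClique l
    · exact hC.isClique_sep l
  refine ⟨?_, fun d hd => ?_⟩
  · rw [alphaEmpty_eq s α hcl]
    exact cellHyper_pos hproper hcl (baseline_mem K)
  · rw [alphaCell_eq s α hcl]
    exact cellHyper_pos hproper hcl (cell_mem_cellsOn.2 hd)
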